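/- Let $H_0$ be the skeleton of the truncated tetrahedron, embedded in the plane: it is the cubic plane graph with vertices $v_1,\dots,v_{12}$ that consists of the four triangles $v_1v_2v_3$, $v_4v_5v_6$, $v_7v_8v_9$, $v_{10}v_{11}v_{12}$ and the six edges $v_3v_4$, $v_6v_7$, $v_9v_{10}$, $v_{12}v_1$, $v_2v_8$, $v_5v_{11}$. For $s\ge 0$ let $H_s$ be the plane graph obtained from $H_0$ by subdividing the edge $v_4v_5$ by $s$ vertices $a_1,\dots,a_s$ (in this order from $v_4$ to $v_5$) and the edge $v_6v_5$ by $s$ vertices $b_1,\dots,b_s$ (in this order from $v_6$ to $v_5$), and by adding the edges $a_ib_i$ for $i=1,\dots,s$; equivalently, for $s\ge 1$, $H_s$ is obtained from $H_{s-1}$ by truncating the vertex $v_5$. Let $L(H_s)$ be the poset of all cells of $H_s$, namely $\emptyset$, the vertices, the edges, the faces (including the outer face), and $H_s$ itself, ordered by inclusion and ranked by dimension ($-1,0,1,2,3$, respectively), and let $G(L(H_s))$ be its cover graph. A rhombic strip of $G(L(H_s))$ is a spanning subgraph of $G(L(H_s))$ embedded on the cylinder $\mathbb{R}^2/((x,y)\sim(x+1,y))$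 such that the height of each vertex is its rank, the edges are straight lines without crossings, and every face of the embedding is a rhombus, i.e., is bounded by a 4-cycle $(a,b,c,d)$ in which $a$ and $c$ have the same rank $r$, and $b$ and $d$ have ranks $r-1$ and $r+1$, respectively. Theorem. For every $s\ge 0$, $H_s$ is a 2-connected plane graph, $H_s$ and its dual graph both have a Hamiltonian cycle, but $G(L(H_s))$ does not have a rhombic strip. -/

import Mathlib

/-! ### Graphs embedded in an oriented surface, their cells, and their duals -/

/-- A nonempty graph without isolated vertices, cellularly embedded in an oriented closed surface, given by
its rotation system: `rot` sends every dart (oriented edge) to the next dart, in counterclockwise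
direction, with the same origin. -/
structure EmbeddedGraph (V : Type*) where
  graph : SimpleGraph V
  rot : Equiv.Perm graph.Dart
  rot_fst : ∀ d, (rot d).fst = d.fst
  rot_sameCycle : ∀ d d' : graph.Dart, d.fst = d'.fst → rot.SameCycle d d'
  nonempty : Nonempty V
  exists_dart : ∀ v, ∃ d : graph.Dart, d.fst = v

namespace EmbeddedGraph

variable {V : Type*} (M : EmbeddedGraph V)

/-- The permutation of the darts that walks along the boundary of the face to the right of a dart:
traverse the dart `u → w`, then continue with the dart that follows `w → u` in the
counterclockwise order around `w`. -/
def facePerm : Equiv.Perm M.graph.Dart where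
  toFun d := M.rot d.symm
  invFun d := (M.rot.symm d).symm
  left_inv d := by simp
  right_inv d := by simp

/-- The faces are the orbits of the face permutation. -/
def Face : Type _ := Quotient (Equiv.Perm.SameCycle.setoid M.facePerm)

/-- The face to the right of a dart. -/
def faceOf (d : M.graph.Dart) : M.Face := Quotient.mk _ d

/-- The embedding is an embedding in the plane (sphere): the graph is finite and connected, and
Euler's formula `|V| - |E| + |F| = 2` holds, that is, the surface has genus zero. -/
def IsPlane : Prop :=
  Finite V ∧ M.graph.Connected ∧
    (Nat.card V : ℤ) - (Nat.card M.graph.edgeSet : ℤ) + (Nat.card M.Face : ℤ) = 2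

/-- The dual graph: its vertices are the faces, and two distinct faces are adjacent if some edge
has one of them on either side. -/
def dual : SimpleGraph M.Face where
  Adj f g := f ≠ g ∧ ∃ d : M.graph.Dart, M.faceOf d = f ∧ M.faceOf d.symm = g
  symm := ⟨by
    rintro f g ⟨h, d, hf, hg⟩
    exact ⟨h.symm, d.symm, hg, by simpa using hf⟩⟩
  loopless := ⟨fun _ h => h.1 rfl⟩

/-- The cells: the vertices, edges and faces, and the two trivial cells `∅` and the whole graph. -/
inductive Cell : Type _
  | empty : Cell
  | vertex (v : V) : Cell
  | edge (e : M.graph.edgeSet) : Cell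
  | face (f : M.Face) : Cell
  | whole : Cell

namespace Cell

variable {M}

/-- The dimension of a cell; the empty cell has dimension `-1` and the whole graph has
dimension `3`. -/
def dim : M.Cell → ℤ
  | empty => -1
  | vertex _ => 0
  | edge _ => 1
  | face _ => 2
  | whole => 3

/-- Strict inclusion of cells. -/
def Lt : M.Cell → M.Cell → Prop
  | empty, empty => False
  | empty, _ => True
  | vertex v, edge e => v ∈ (e : Sym2 V)
  | vertex v, face f => ∃ d : M.graph.Dart, d.fst = v ∧ M.faceOf d = f
  | edge e, face f => ∃ d : M.graph.Dart, d.edge = e ∧ M.faceOf d = f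
  | whole, whole => False
  | _, whole => True
  | _, _ => False

theorem Lt.dim_lt : ∀ {x y : M.Cell}, Lt x y → x.dim < y.dim := by
  intro x y h
  cases x <;> cases y <;> simp_all [Lt, dim]

theorem faceOf_facePerm (d : M.graph.Dart) : M.faceOf (M.facePerm d) = M.faceOf d :=
  Quotient.sound (s := Equiv.Perm.SameCycle.setoid M.facePerm)
    (show M.facePerm.SameCycle (M.facePerm d) d from
      Equiv.Perm.sameCycle_apply_left.2 (Equiv.Perm.SameCycle.refl _ _))

theorem facePerm_fst (d : M.graph.Dart) : (M.facePerm d).fst = d.snd :=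
  M.rot_fst d.symm

theorem Lt.trans : ∀ {x y z : M.Cell}, Lt x y → Lt y z → Lt x z := by
  intro x y z h₁ h₂
  cases x <;> cases y <;> cases z <;> try simp_all [Lt]
  rename_i v e f
  obtain ⟨d, hd, hf⟩ := h₂
  rw [← hd] at h₁
  have hv : v = d.fst ∨ v = d.snd := Sym2.mem_iff.1 h₁
  rcases hv with rfl | rfl
  · exact ⟨d, rfl, hf⟩
  · exact ⟨M.facePerm d, facePerm_fst d, (faceOf_facePerm d).trans hf⟩

/-- The inclusion order of the cells. -/
instance : PartialOrder M.Cell where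
  le x y := x = y ∨ Lt x y
  lt x y := Lt x y
  le_refl _ := Or.inl rfl
  le_trans x y z := by
    rintro (rfl | h₁) (rfl | h₂)
    · exact Or.inl rfl
    · exact Or.inr h₂
    · exact Or.inr h₁
    · exact Or.inr (h₁.trans h₂)
  le_antisymm x y := by
    rintro (rfl | h₁) (h | h₂)
    · rfl
    · rfl
    · exact h.symm
    · exact absurd (h₁.dim_lt.trans h₂.dim_lt) (lt_irrefl _)
  lt_iff_le_not_ge x y := by
    constructor
    · intro h
      refine ⟨Or.inr h, ?_⟩
      rintro (rfl | h')
      · exact lt_irrefl _ h.dim_lt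
      · exact lt_irrefl _ (h.dim_lt.trans h'.dim_lt)
    · rintro ⟨rfl | h, h'⟩
      · exact absurd (Or.inl rfl) h'
      · exact h

theorem lt_def {x y : M.Cell} : x < y ↔ Lt x y := Iff.rfl

theorem exists_between {x y : M.Cell} (h : Lt x y) (hd : x.dim + 1 < y.dim) :
    ∃ z, Lt x z ∧ Lt z y := by
  cases x <;> cases y <;> simp [dim] at hd <;> simp only [Lt] at h
  case empty.edge e =>
    obtain ⟨⟨u, w⟩, he⟩ := e
    exact ⟨vertex u, trivial, Sym2.mem_mk_left u w⟩
  case empty.face f =>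
    induction f using Quotient.inductionOn with
    | _ d => exact ⟨vertex d.fst, trivial, d, rfl, rfl⟩
  case empty.whole =>
    exact ⟨vertex M.nonempty.some, trivial, trivial⟩
  case vertex.face v f =>
    obtain ⟨d, rfl, hf⟩ := h
    exact ⟨edge ⟨d.edge, d.edge_mem⟩, Sym2.mem_mk_left _ _, d, rfl, hf⟩
  case vertex.whole v =>
    obtain ⟨d, rfl⟩ := M.exists_dart v
    exact ⟨face (M.faceOf d), ⟨d, rfl, rfl⟩, trivial⟩
  case edge.whole e =>
    obtain ⟨⟨u, w⟩, he⟩ := e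
    exact ⟨face (M.faceOf ⟨(u, w), he⟩), ⟨⟨(u, w), he⟩, rfl, rfl⟩, trivial⟩

/-- The inclusion order of the cells is graded by dimension. -/
instance : GradeOrder ℤ M.Cell where
  grade := dim
  grade_strictMono _ _ h := Lt.dim_lt h
  covBy_grade x y h := by
    rw [Order.covBy_iff_add_one_eq]
    refine le_antisymm (Int.add_one_le_iff.2 (Lt.dim_lt h.lt)) (not_lt.1 fun hd => ?_)
    obtain ⟨z, h₁, h₂⟩ := exists_between h.lt hd
    exact h.2 h₁ h₂

end Cell

section Cubic

variable {V : Type*} (nbr : V → Fin 3 → V)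

/-- The graph in which the neighbours of `u` are the vertices `nbr u k`. -/
def cubicGraph (hsymm : ∀ u k, ∃ l, nbr (nbr u k) l = u) (hne : ∀ u k, nbr u k ≠ u) :
    SimpleGraph V where
  Adj u w := ∃ k, nbr u k = w
  symm := ⟨by rintro u _ ⟨k, rfl⟩; exact hsymm u k⟩
  loopless := ⟨fun u ⟨k, hk⟩ => hne u k hk⟩

/-- The pair `(u, k)` stands for the dart `u → nbr u k`. -/
noncomputable def cubicDart (hsymm : ∀ u k, ∃ l, nbr (nbr u k) l = u) (hne : ∀ u k, nbr u k ≠ u)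
    (hinj : ∀ u, Function.Injective (nbr u)) : V × Fin 3 ≃ (cubicGraph nbr hsymm hne).Dart :=
  Equiv.ofBijective (fun p => ⟨(p.1, nbr p.1 p.2), ⟨p.2, rfl⟩⟩) (by
    constructor
    · rintro ⟨u, k⟩ ⟨u', k'⟩ h
      have h' := congrArg SimpleGraph.Dart.toProd h
      simp only [Prod.mk.injEq] at h'
      obtain ⟨rfl, h₂⟩ := h'
      rw [hinj u h₂]
    · rintro ⟨⟨u, w⟩, h⟩
      obtain ⟨k, hk⟩ := h
      exact ⟨(u, k), SimpleGraph.Dart.ext _ _ (Prod.ext rfl hk)⟩)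

/-- The embedded cubic graph in which `nbr u 0, nbr u 1, nbr u 2` are the neighbours of the
vertex `u`, in counterclockwise order around `u`. -/
noncomputable def ofCubic [Nonempty V] (hsymm : ∀ u k, ∃ l, nbr (nbr u k) l = u)
    (hne : ∀ u k, nbr u k ≠ u) (hinj : ∀ u, Function.Injective (nbr u)) : EmbeddedGraph V where
  graph := cubicGraph nbr hsymm hne
  rot := (cubicDart nbr hsymm hne hinj).permCongr
    (Equiv.prodCongr (Equiv.refl V) (Equiv.addRight 1))
  rot_fst d := by
    obtain ⟨p, rfl⟩ := (cubicDart nbr hsymm hne hinj).surjective d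
    rw [Equiv.permCongr_apply, Equiv.symm_apply_apply]
    rfl
  rot_sameCycle d d' h := by
    set φ := cubicDart nbr hsymm hne hinj
    set r := φ.permCongr (Equiv.prodCongr (Equiv.refl V) (Equiv.addRight 1))
    obtain ⟨⟨u, k⟩, rfl⟩ := φ.surjective d
    obtain ⟨⟨u', k'⟩, rfl⟩ := φ.surjective d'
    obtain rfl : u = u' := h
    have step : ∀ l : Fin 3, r.SameCycle (φ (u, l)) (φ (u, l + 1)) := by
      intro l
      refine ⟨1, ?_⟩
      rw [zpow_one, Equiv.permCongr_apply, Equiv.symm_apply_apply]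
      rfl
    have all : ∀ l : Fin 3, r.SameCycle (φ (u, 0)) (φ (u, l)) := by
      intro l
      fin_cases l
      · exact Equiv.Perm.SameCycle.refl _ _
      · exact step 0
      · exact (step 0).trans (step 1)
    exact (all k).symm.trans (all k')
  nonempty := inferInstance
  exists_dart u := ⟨cubicDart nbr hsymm hne hinj (u, 0), rfl⟩

end Cubic

end EmbeddedGraph

/-! ### Hamiltonian cycles and 2-connectedness -/

open Classical in
/-- The graph has a cycle that visits every vertex exactly once. -/
def HasHamiltonianCycle {V : Type*} (G : SimpleGraph V) : Prop :=
  ∃ (v : V) (p : G.Walk v v), p.IsHamiltonianCycle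

/-- The graph has at least three vertices, is connected, and stays connected when any single
vertex is deleted. -/
def IsTwoConnected {V : Type*} (G : SimpleGraph V) : Prop :=
  (∃ u v w : V, u ≠ v ∧ v ≠ w ∧ u ≠ w) ∧ G.Connected ∧ ∀ v, (G.induce {v}ᶜ).Connected

/-! ### Rhombic strips -/

/-- The covering map from the plane to the cylinder `ℝ² / (x, y) ∼ (x + 1, y)`. -/
noncomputable def toCylinder (p : ℝ × ℝ) : AddCircle (1 : ℝ) × ℝ := ((p.1 : AddCircle (1 : ℝ)), p.2)

/-- A spanning subgraph of the cover graph of a graded poset, drawn on the cylinder. The vertex `x`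
is drawn at horizontal position `pos x` (modulo 1) and at the height given by its rank. An edge
`x ⋖ y` is drawn as a straight line segment on the cylinder, that is, as the image of a segment of
the plane from the chosen lift of `x` to some lift of `y`; the lift of `y` is given by the integer
`wind x y`, which is the number of times by which the segment winds around the cylinder relative to
the chosen lifts. -/
structure CylinderDrawing (P : Type*) [PartialOrder P] [GradeOrder ℤ P] where
  graph : SimpleGraph P
  graph_le : graph ≤ SimpleGraph.hasse P
  pos : P → ℝ
  wind : P → P → ℤ

namespace CylinderDrawing

variable {P : Type*} [PartialOrder P] [GradeOrder ℤ P] (D : CylinderDrawing P)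

/-- `x ⋖ y` is an edge of the drawn graph. -/
def UpEdge (x y : P) : Prop := D.graph.Adj x y ∧ x ⋖ y

/-- The point of the cylinder that represents a vertex. -/
noncomputable def point (x : P) : AddCircle (1 : ℝ) × ℝ := toCylinder (D.pos x, (grade ℤ x : ℝ))

/-- The straight line segment on the cylinder that represents an edge `x ⋖ y`. -/
noncomputable def arc (x y : P) : Set (AddCircle (1 : ℝ) × ℝ) :=
  toCylinder '' segment ℝ (D.pos x, (grade ℤ x : ℝ)) (D.pos y + D.wind x y, (grade ℤ y : ℝ))

/-- The set of all points of the cylinder that lie on the drawing. -/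
noncomputable def carrier : Set (AddCircle (1 : ℝ) × ℝ) :=
  {p | (∃ x, p = D.point x) ∨ ∃ x y, D.UpEdge x y ∧ p ∈ D.arc x y}

/-- Distinct vertices are drawn at distinct points, and two distinct edges meet only in common
end vertices. (An edge cannot meet itself or pass through a further vertex, as its height is
strictly monotone between two consecutive integers.) -/
def NonCrossing : Prop :=
  Function.Injective D.point ∧
    ∀ x y x' y', D.UpEdge x y → D.UpEdge x' y' → (x, y) ≠ (x', y') →
      D.arc x y ∩ D.arc x' y' ⊆ D.point '' (({x, y} : Set P) ∩ {x', y'})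

/-- `U` is a face of the drawing: a connected component of the complement of the drawing. -/
def IsFace (U : Set (AddCircle (1 : ℝ) × ℝ)) : Prop :=
  ∃ p ∈ D.carrierᶜ, U = connectedComponentIn D.carrierᶜ p

/-- The region `U` is a rhombus: it is bounded by a 4-cycle `(a, b, c, d)` of the drawn graph in
which `a` and `c` have the same rank `r`, and `b` and `d` have rank `r - 1` and `r + 1`. -/
def IsRhombus (U : Set (AddCircle (1 : ℝ) × ℝ)) : Prop :=
  ∃ a b c d : P, a ≠ c ∧ D.UpEdge b a ∧ D.UpEdge b c ∧ D.UpEdge a d ∧ D.UpEdge c d ∧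
    frontier U = D.arc b a ∪ D.arc b c ∪ D.arc a d ∪ D.arc c d

end CylinderDrawing

/-- The cover graph of the graded poset `P` has a rhombic strip: a spanning subgraph of it can be
drawn on the cylinder, with heights given by the ranks, with straight edges and without crossings,
so that every face is a rhombus. -/
def HasRhombicStrip (P : Type*) [PartialOrder P] [GradeOrder ℤ P] : Prop :=
  ∃ D : CylinderDrawing P, D.NonCrossing ∧ ∀ U, D.IsFace U → D.IsRhombus U

/-! ### The iterated truncations of the truncated tetrahedron -/

/-- The vertices of the graph `H_s`; `a i` and `b i` stand for `a_{i+1}` and `b_{i+1}`. -/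
inductive TVertex (s : ℕ) : Type
  | v1 | v2 | v3 | v4 | v5 | v6 | v7 | v8 | v9 | v10 | v11 | v12
  | a (i : Fin s)
  | b (i : Fin s)
  deriving DecidableEq, Fintype

namespace TVertex

/-- The subdivided edge `v_4, a_1, …, a_s, v_5`. -/
def railA (s : ℕ) : ℕ → TVertex s
  | 0 => v4
  | i + 1 => if h : i < s then a ⟨i, h⟩ else v5

/-- The subdivided edge `v_6, b_1, …, b_s, v_5`. -/
def railB (s : ℕ) : ℕ → TVertex s
  | 0 => v6
  | i + 1 => if h : i < s then b ⟨i, h⟩ else v5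

/-- The three neighbours of each vertex, in counterclockwise order, in a plane drawing of `H_s`.
For `s = 0` this is the skeleton of the truncated tetrahedron, with the triangles `v_1 v_2 v_3`,
`v_4 v_5 v_6`, `v_7 v_8 v_9`, `v_10 v_11 v_12`, any two of which are joined by an edge: `v_3 v_4`,
`v_6 v_7`, `v_9 v_10`, `v_12 v_1`, `v_2 v_8` and `v_5 v_11`. For general `s` the edges `v_4 v_5` and
`v_6 v_5` are subdivided by `a_1, …, a_s` and `b_1, …, b_s`, and the edges `a_i b_i` are added. -/
def nbr (s : ℕ) : TVertex s → Fin 3 → TVertex s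
  | v1 => ![v2, v12, v3]
  | v2 => ![v3, v8, v1]
  | v3 => ![v4, v2, v1]
  | v4 => ![railA s 1, v6, v3]
  | v5 => ![railB s s, railA s s, v11]
  | v6 => ![v7, v4, railB s 1]
  | v7 => ![v8, v6, v9]
  | v8 => ![v9, v2, v7]
  | v9 => ![v10, v8, v7]
  | v10 => ![v11, v12, v9]
  | v11 => ![v12, v10, v5]
  | v12 => ![v1, v10, v11]
  | a i => ![railA s (i + 2), b i, railA s i]
  | b i => ![railB s i, a i, railB s (i + 2)]

instance (s : ℕ) : Nonempty (TVertex s) := ⟨v1⟩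

theorem nbr_railA {s i : ℕ} (hi : i ≤ s) :
    (∃ k, nbr s (railA s i) k = railA s (i + 1)) ∧ ∃ k, nbr s (railA s (i + 1)) k = railA s i := by
  constructor
  · cases i with
    | zero => exact ⟨0, by simp [railA, nbr]⟩
    | succ i => exact ⟨0, by simp [railA, nbr, show i < s by omega]⟩
  · by_cases h : i < s
    · exact ⟨2, by simp [railA, nbr, h]⟩
    · obtain rfl : i = s := by omega
      exact ⟨1, by simp [railA, nbr]⟩

theorem nbr_railB {s i : ℕ} (hi : i ≤ s) :
    (∃ k, nbr s (railB s i) k = railB s (i + 1)) ∧ ∃ k, nbr s (railB s (i + 1)) k = railB s i := by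
  constructor
  · cases i with
    | zero => exact ⟨2, by simp [railB, nbr]⟩
    | succ i => exact ⟨2, by simp [railB, nbr, show i < s by omega]⟩
  · by_cases h : i < s
    · exact ⟨0, by simp [railB, nbr, h]⟩
    · obtain rfl : i = s := by omega
      exact ⟨0, by simp [railB, nbr]⟩

theorem railA_last (s : ℕ) : railA s (s + 1) = v5 := by simp [railA]

theorem railB_last (s : ℕ) : railB s (s + 1) = v5 := by simp [railB]

theorem railA_mid {s : ℕ} (i : Fin s) : railA s (i + 1) = a i := by simp [railA]

theorem railB_mid {s : ℕ} (i : Fin s) : railB s (i + 1) = b i := by simp [railB]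

theorem nbr_symm (s : ℕ) (u : TVertex s) (k : Fin 3) : ∃ l, nbr s (nbr s u k) l = u := by
  have e : ∀ w : TVertex s, (nbr s w 0 = u ∨ nbr s w 1 = u ∨ nbr s w 2 = u) →
      ∃ l, nbr s w l = u := by
    rintro w (h | h | h)
    exacts [⟨0, h⟩, ⟨1, h⟩, ⟨2, h⟩]
  have hA := (nbr_railA (le_refl s)).1
  have hB := (nbr_railB (le_refl s)).1
  have hA₀ := (nbr_railA (Nat.zero_le s)).2
  have hB₀ := (nbr_railB (Nat.zero_le s)).2
  rw [railA_last] at hA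
  rw [railB_last] at hB
  cases u
  case a i =>
    have hi := i.2
    have h₁ := (nbr_railA (s := s) (i := (i : ℕ) + 1) (by omega)).2
    have h₂ := (nbr_railA (s := s) (i := (i : ℕ)) (by omega)).1
    rw [railA_mid] at h₁ h₂
    fin_cases k
    exacts [h₁, ⟨1, rfl⟩, h₂]
  case b i =>
    have hi := i.2
    have h₁ := (nbr_railB (s := s) (i := (i : ℕ) + 1) (by omega)).2
    have h₂ := (nbr_railB (s := s) (i := (i : ℕ)) (by omega)).1
    rw [railB_mid] at h₁ h₂
    fin_cases k
    exacts [h₂, ⟨1, rfl⟩, h₁]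
  all_goals
    fin_cases k <;> first
      | exact hA
      | exact hB
      | exact hA₀
      | exact hB₀
      | exact e _ (by simp [nbr])

theorem nbr_ne (s : ℕ) (u : TVertex s) (k : Fin 3) : nbr s u k ≠ u := by
  rcases s with _ | s
  · cases u <;> fin_cases k <;> first | (rename_i i; exact i.elim0) | simp [nbr, railA, railB]
  · cases u
    case a i =>
      obtain ⟨i, hi⟩ := i
      fin_cases k
      · simp only [nbr, railA]; split_ifs <;> simp
      · simp [nbr]
      · cases i <;> simp [nbr, railA]; split_ifs <;> simp
    case b i =>
      obtain ⟨i, hi⟩ := i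
      fin_cases k
      · cases i <;> simp [nbr, railB]; split_ifs <;> simp
      · simp [nbr]
      · simp only [nbr, railB]; split_ifs <;> simp
    all_goals fin_cases k <;> simp [nbr, railA, railB]

theorem nbr_injective (s : ℕ) (u : TVertex s) : Function.Injective (nbr s u) := by
  have key : ∀ w : TVertex s, nbr s w 0 ≠ nbr s w 1 → nbr s w 0 ≠ nbr s w 2 →
      nbr s w 1 ≠ nbr s w 2 → Function.Injective (nbr s w) := by
    intro w h₁ h₂ h₃ k l h
    fin_cases k <;> fin_cases l <;> simp_all
  rcases s with _ | s
  · cases u <;> first | (rename_i i; exact i.elim0) | (apply key <;> simp [nbr, railA, railB])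
  · cases u
    case a i =>
      obtain ⟨i, hi⟩ := i
      apply key
      · simp only [nbr, railA]; split_ifs <;> simp
      · cases i <;> simp [nbr, railA] <;> split_ifs <;> simp <;> omega
      · cases i <;> simp [nbr, railA]; split_ifs <;> simp
    case b i =>
      obtain ⟨i, hi⟩ := i
      apply key
      · cases i <;> simp [nbr, railB]; split_ifs <;> simp
      · cases i <;> simp [nbr, railB] <;> split_ifs <;> simp <;> omega
      · simp only [nbr, railB]; split_ifs <;> simp
    all_goals apply key <;> simp [nbr, railA, railB]

end TVertex

/-- The plane graph `H_s`: the truncated tetrahedron, with its vertex `v_5` truncated `s` times. -/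
noncomputable def truncTetra (s : ℕ) : EmbeddedGraph (TVertex s) :=
  EmbeddedGraph.ofCubic (TVertex.nbr s) (TVertex.nbr_symm s) (TVertex.nbr_ne s)
    (TVertex.nbr_injective s)

/-! ### The combinatorics of a rhombic drawing -/

/-! The obstruction is a count of the graph edges, i.e. the elements of rank 1. In a strip, take two
cyclically consecutive elements `x`, `y` of one rank. The open horizontal segment between them
misses the drawing, so it lies in one face; that face is a rhombus with `x` and `y` on its boundary,
and ranks force them to be its two middle corners. Hence every element shares a drawn lower and a
drawn upper neighbour with each of two other elements of its rank (`exists_opposite`).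

Call a graph edge down-double if both its ends are joined to it in the strip, and up-double if both
its faces are. Sending a down-double edge to its left lower neighbour is injective, since a
collision would make two segments cross; so there are at most |V| of them, and dually at most |F|
up-double ones. Every edge is of at least one kind: otherwise it and its two neighbours in the strip
would be three edges at one vertex on one face, impossible at a cubic vertex. By Euler's formula |V|
+ |F| = |E| + 2, so at most two edges are of both kinds.

A triangle, however, always contains an edge of both kinds: at each vertex at most one edge fails to
be down-double, so at most one side fails, while the triangular face needs two up-double sides.
Three disjoint triangles, away from the ladder, already exceed the bound.

The positive claims come from explicit cyclic enumerations of vertices and faces. The faces are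
orbits, so their enumeration needs a numbering of darts that is constant on orbits
(`exists_label_eq`) and separates them (`faceNum_label`). The same enumerations give the
cardinalities used for planarity and for the count. -/

theorem toCylinder_eq_iff {p q : ℝ × ℝ} :
    toCylinder p = toCylinder q ↔ p.2 = q.2 ∧ ∃ k : ℤ, q.1 = p.1 + k := by
  simp only [toCylinder, Prod.mk.injEq]
  rw [and_comm, eq_comm (a := (p.1 : AddCircle (1 : ℝ))),
    ← sub_eq_zero (a := (q.1 : AddCircle (1 : ℝ))), ← AddCircle.coe_sub, AddCircle.coe_eq_zero_iff]
  simp only [zsmul_eq_mul, mul_one, eq_comm, sub_eq_iff_eq_add']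

theorem continuous_toCylinder : Continuous toCylinder :=
  ((AddCircle.continuous_mk' (1 : ℝ)).comp continuous_fst).prodMk continuous_snd

namespace CylinderDrawing

variable {P : Type*} [PartialOrder P] [GradeOrder ℤ P] {D : CylinderDrawing P}

theorem point_eq_iff {x y : P} :
    D.point x = D.point y ↔ grade ℤ x = grade ℤ y ∧ ∃ k : ℤ, D.pos y = D.pos x + k := by
  simp [point, toCylinder_eq_iff]

theorem UpEdge.grade_eq {x y : P} (h : D.UpEdge x y) : grade ℤ y = grade ℤ x + 1 :=
  (Order.covBy_iff_add_one_eq.1 (h.2.grade ℤ)).symm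

/-- As the ranks differ by one, the segment parameter `θ` is the height above `x`; the integer `k`
absorbs the choice of lift of the point. -/
theorem UpEdge.mem_arc_iff {x y : P} {p : ℝ × ℝ} (h : D.UpEdge x y) :
    toCylinder p ∈ D.arc x y ↔ ∃ θ ∈ Set.Icc (0 : ℝ) 1, p.2 = grade ℤ x + θ ∧
      ∃ k : ℤ, p.1 = (1 - θ) * D.pos x + θ * (D.pos y + D.wind x y) + k := by
  simp only [arc, segment_eq_image, Set.mem_image, exists_exists_and_eq_and, toCylinder_eq_iff,
    h.grade_eq]
  refine exists_congr fun θ => and_congr_right fun _ => and_congr ?_ ?_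
  · simp only [Prod.smul_mk, Prod.mk_add_mk, smul_eq_mul]
    push_cast
    rw [eq_comm]
    ring_nf
  · simp

/-- A vertex on an edge is one of its end points. -/
theorem NonCrossing.eq_or_eq_of_point_mem_arc (hD : D.NonCrossing) {x y z : P}
    (h : D.UpEdge x y) (hz : D.point z ∈ D.arc x y) : z = x ∨ z = y := by
  obtain ⟨θ, hθ, h₁, k, h₂⟩ := h.mem_arc_iff.1 hz
  dsimp only at h₁ h₂
  -- Vertices have integer height, so `θ` is an integer in [0, 1] and the point is an end of the
  -- segment.
  have h₃ : θ = ((grade ℤ z - grade ℤ x : ℤ) : ℝ) := by push_cast; linarith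
  have h₄ : 0 ≤ grade ℤ z - grade ℤ x := by exact_mod_cast h₃ ▸ hθ.1
  have h₅ : grade ℤ z - grade ℤ x ≤ 1 := by exact_mod_cast h₃ ▸ hθ.2
  obtain h₆ | h₆ : grade ℤ z - grade ℤ x = 0 ∨ grade ℤ z - grade ℤ x = 1 := by omega
  · left
    refine hD.1 (point_eq_iff.2 ⟨by omega, -k, ?_⟩)
    rw [h₂, h₃, h₆]
    push_cast
    ring
  · right
    refine hD.1 (point_eq_iff.2 ⟨by rw [h.grade_eq]; omega, D.wind x y * (-1) - k, ?_⟩)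
    rw [h₂, h₃, h₆]
    push_cast
    ring

/-- Edges do not cross, in terms of the lifts of their end points. -/
theorem NonCrossing.le_of_lt (hD : D.NonCrossing) {x y x' y' : P} (h : D.UpEdge x y)
    (h' : D.UpEdge x' y') (hg : grade ℤ x = grade ℤ x') {k : ℤ}
    (hlt : D.pos x < D.pos x' + k) :
    D.pos y + D.wind x y ≤ D.pos y' + D.wind x' y' + k := by
  by_contra! hlt'
  have hne : (x, y) ≠ (x', y') := by
    rintro ⟨⟩
    linarith
  set X := D.pos x
  set X' := D.pos x' + k with hX'
  set Y := D.pos y + D.wind x y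
  set Y' := D.pos y' + D.wind x' y' + k with hY'
  have hpos : 0 < (X' - X) + (Y - Y') := by linarith
  -- The relative height at which the two lifted segments, whose order is reversed between bottom
  -- and top, have the same abscissa.
  obtain ⟨θ, hθ⟩ : ∃ θ, θ = (X' - X) / ((X' - X) + (Y - Y')) := ⟨_, rfl⟩
  have hθ₀ : 0 < θ := hθ ▸ div_pos (by linarith) hpos
  have hθ₁ : θ < 1 := by rw [hθ, div_lt_one hpos]; linarith
  have hmeet : (1 - θ) * X + θ * Y = (1 - θ) * X' + θ * Y' := by
    rw [hθ]
    field_simp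
    ring
  -- The meeting point would have to be a vertex, but its height lies strictly between consecutive
  -- integers.
  obtain ⟨z, -, hz⟩ := hD.2 x y x' y' h h' hne
    (⟨h.mem_arc_iff (p := ((1 - θ) * X + θ * Y, grade ℤ x + θ)) |>.2
        ⟨θ, ⟨hθ₀.le, hθ₁.le⟩, rfl, 0, by simp [X, Y]⟩,
      h'.mem_arc_iff.2 ⟨θ, ⟨hθ₀.le, hθ₁.le⟩, by simp [hg], k, by
        dsimp only
        rw [hmeet, hX', hY']
        ring⟩⟩)
  have hz' := (toCylinder_eq_iff.1 hz).1
  dsimp only at hz'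
  have h₁ : θ = ((grade ℤ z - grade ℤ x : ℤ) : ℝ) := by push_cast; linarith
  have h₂ : 0 < grade ℤ z - grade ℤ x := by exact_mod_cast h₁ ▸ hθ₀
  have h₃ : grade ℤ z - grade ℤ x < 1 := by exact_mod_cast h₁ ▸ hθ₁
  omega

/-! ### Neighbours within one rank of a strip -/

variable (D) in
/-- Two distinct elements are opposite corners, of the same rank, of a 4-cycle of the drawn
graph. -/
def Opposite (x y : P) : Prop :=
  x ≠ y ∧ ∃ b d, D.UpEdge b x ∧ D.UpEdge b y ∧ D.UpEdge x d ∧ D.UpEdge y d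

theorem Opposite.symm {x y : P} : D.Opposite x y → D.Opposite y x :=
  fun ⟨h, b, d, h₁, h₂, h₃, h₄⟩ => ⟨h.symm, b, d, h₂, h₁, h₄, h₃⟩

/-- The right and left end of a gap between the elements of one rank are opposite. -/
theorem NonCrossing.opposite_of_gap (hD : D.NonCrossing) (hR : ∀ U, D.IsFace U → D.IsRhombus U)
    {x y : P} (hne : x ≠ y) (hg : grade ℤ x = grade ℤ y) {δ : ℝ} (hδ : 0 < δ) {k : ℤ}
    (hy : D.pos y = D.pos x + δ + k)
    (hgap : ∀ z (t : ℝ) (k : ℤ), grade ℤ z = grade ℤ x → 0 < t → t < δ →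
      D.pos z ≠ D.pos x + t + k) :
    D.Opposite x y := by
  set γ : ℝ → AddCircle (1 : ℝ) × ℝ := fun t => toCylinder (D.pos x + t, grade ℤ x) with hγ
  have hγc : Continuous γ := continuous_toCylinder.comp (by fun_prop)
  -- An edge meets an integer height only at its end vertices, and the gap contains no vertex.
  have hsub : γ '' Set.Ioo 0 δ ⊆ D.carrierᶜ := by
    rintro _ ⟨t, ⟨ht₀, ht₁⟩, rfl⟩
    have key : ∀ z, γ t ≠ D.point z := by
      intro z hz
      obtain ⟨h₁, k, h₂⟩ := toCylinder_eq_iff.1 hz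
      exact hgap z t k (Int.cast_injective h₁.symm) ht₀ ht₁ h₂
    rintro (⟨z, hz⟩ | ⟨u, w, h, hp⟩)
    · exact key z hz
    · obtain ⟨θ, hθ, h₁, l, h₂⟩ := h.mem_arc_iff.1 hp
      dsimp only at h₁ h₂
      have h₃ : θ = ((grade ℤ x - grade ℤ u : ℤ) : ℝ) := by push_cast; linarith
      have h₄ : 0 ≤ grade ℤ x - grade ℤ u := by exact_mod_cast h₃ ▸ hθ.1
      have h₅ : grade ℤ x - grade ℤ u ≤ 1 := by exact_mod_cast h₃ ▸ hθ.2
      obtain h₆ | h₆ : grade ℤ x - grade ℤ u = 0 ∨ grade ℤ x - grade ℤ u = 1 := by omega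
      · refine key u (toCylinder_eq_iff.2 ⟨by simp only [Int.cast_inj]; omega, -l, ?_⟩)
        dsimp only
        rw [h₂, h₃, h₆]
        push_cast
        ring
      · refine key w (toCylinder_eq_iff.2
          ⟨by simp only [Int.cast_inj, h.grade_eq]; omega, D.wind u w * (-1) - l, ?_⟩)
        dsimp only
        rw [h₂, h₃, h₆]
        push_cast
        ring
  have hmid : γ (δ / 2) ∈ γ '' Set.Ioo 0 δ := ⟨_, ⟨by linarith, by linarith⟩, rfl⟩
  set U := connectedComponentIn D.carrierᶜ (γ (δ / 2)) with hU
  have hIU : γ '' Set.Ioo 0 δ ⊆ U :=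
    (isPreconnected_Ioo.image _ hγc.continuousOn).subset_connectedComponentIn hmid hsub
  have hcl : ∀ t ∈ Set.Icc 0 δ, γ t ∈ closure U := by
    intro t ht
    rw [← closure_Ioo hδ.ne] at ht
    exact closure_mono hIU (image_closure_subset_closure_image hγc ⟨t, ht, rfl⟩)
  -- The ends of the gap are limits of points of `U` but belong to the drawing, hence not to `U`.
  have hfr : ∀ t ∈ Set.Icc 0 δ, ∀ z, γ t = D.point z → D.point z ∈ frontier U := by
    intro t ht z hz
    rw [← closure_sdiff_interior]
    exact ⟨hz ▸ hcl t ht, fun h =>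
      connectedComponentIn_subset _ _ (interior_subset h) (Or.inl ⟨z, rfl⟩)⟩
  have hxU := hfr 0 ⟨le_rfl, hδ.le⟩ x (by simp [hγ, point])
  have hyU := hfr δ ⟨hδ.le, le_rfl⟩ y (toCylinder_eq_iff.2 ⟨by simp [hg], k, hy⟩)
  obtain ⟨a, b, c, d, hac, hba, hbc, had, hcd, hF⟩ := hR U ⟨_, hsub hmid, rfl⟩
  rw [hF] at hxU hyU
  have corner : ∀ z, D.point z ∈ D.arc b a ∪ D.arc b c ∪ D.arc a d ∪ D.arc c d →
      z = a ∨ z = b ∨ z = c ∨ z = d := by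
    rintro z (((h | h) | h) | h)
    · have := hD.eq_or_eq_of_point_mem_arc hba h; tauto
    · have := hD.eq_or_eq_of_point_mem_arc hbc h; tauto
    · have := hD.eq_or_eq_of_point_mem_arc had h; tauto
    · have := hD.eq_or_eq_of_point_mem_arc hcd h; tauto
  have g₁ := hba.grade_eq
  have g₂ := hbc.grade_eq
  have g₃ := had.grade_eq
  -- Equal rank and `x ≠ y` exclude everything except `{x, y} = {a, c}`.
  rcases corner x hxU with rfl | rfl | rfl | rfl <;>
    rcases corner y hyU with rfl | rfl | rfl | rfl <;>
      first
        | exact absurd rfl hne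
        | omega
        | exact ⟨hne, b, d, hba, hbc, had, hcd⟩
        | exact ⟨hne, b, d, hbc, hba, hcd, had⟩

/-- In a drawing all of whose faces are rhombi, every element is opposite to two others of its
rank. -/
theorem NonCrossing.exists_opposite [Finite P] (hD : D.NonCrossing)
    (hR : ∀ U, D.IsFace U → D.IsRhombus U) {x u v : P} (hu : grade ℤ u = grade ℤ x)
    (hv : grade ℤ v = grade ℤ x) (hux : u ≠ x) (hvx : v ≠ x) (huv : u ≠ v) :
    ∃ y z, y ≠ z ∧ D.Opposite x y ∧ D.Opposite x z := by
  set S : Set P := {y | grade ℤ y = grade ℤ x ∧ y ≠ x} with hS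
  -- The distance from `x` to `y` going right around the circle; its minimum and maximum on `S` give
  -- the right and left neighbours of `x`.
  set φ : P → ℝ := fun y => Int.fract (D.pos y - D.pos x) with hφ
  have huS : u ∈ S := ⟨hu, hux⟩
  have inj : ∀ y ∈ S, ∀ z ∈ S, φ y = φ z → y = z := by
    intro y hy z hz h
    obtain ⟨k, hk⟩ := Int.fract_eq_fract.1 h
    exact hD.1 (point_eq_iff.2 ⟨hy.1.trans hz.1.symm, -k, by push_cast; linarith⟩)
  have pos : ∀ y ∈ S, 0 < φ y := by
    intro y hy
    refine (Int.fract_nonneg _).lt_of_ne fun h => hy.2 ?_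
    exact hD.1 (point_eq_iff.2 ⟨hy.1, -⌊D.pos y - D.pos x⌋, by
      have := Int.floor_add_fract (D.pos y - D.pos x)
      rw [← h] at this
      push_cast
      linarith⟩)
  have eval : ∀ y (t : ℝ) (k : ℤ), 0 ≤ t → t < 1 → D.pos y = D.pos x + t + k → φ y = t := by
    intro y t k h₀ h₁ h
    rw [hφ, Int.fract_eq_iff]
    exact ⟨h₀, h₁, k, by rw [h]; ring⟩
  have pos_eq : ∀ y, D.pos y = D.pos x + φ y + ⌊D.pos y - D.pos x⌋ := by
    intro y
    have := Int.floor_add_fract (D.pos y - D.pos x)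
    simp only [hφ]
    linarith
  obtain ⟨y, hyS, hy⟩ := Set.exists_min_image S φ S.toFinite ⟨u, huS⟩
  obtain ⟨z, hzS, hz⟩ := Set.exists_max_image S φ S.toFinite ⟨u, huS⟩
  have hy₁ : φ y < 1 := Int.fract_lt_one _
  have hz₁ : φ z < 1 := Int.fract_lt_one _
  refine ⟨y, z, ?_, ?_, Opposite.symm ?_⟩
  -- If the two neighbours coincided, `φ` would be constant on `S`, contradicting `u ≠ v`.
  · rintro rfl
    exact huv (inj u huS v ⟨hv, hvx⟩ (le_antisymm ((hz u huS).trans (hy v ⟨hv, hvx⟩))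
      ((hz v ⟨hv, hvx⟩).trans (hy u huS))))
  · refine hD.opposite_of_gap hR hyS.2.symm hyS.1.symm (pos y hyS) (pos_eq y) ?_
    intro w t k hw ht₀ ht₁ h
    have hwt := eval w t k ht₀.le (ht₁.trans hy₁) h
    have hwx : w ≠ x := by
      rintro rfl
      simp [hφ] at hwt
      linarith
    exact absurd (hy w ⟨hw, hwx⟩) (by linarith)
  -- The gap from `z` rightwards to `x` completes the turn, whence the length `1 - φ z` and the
  -- extra `-1` in the lift.
  · refine hD.opposite_of_gap hR hzS.2 hzS.1 (δ := 1 - φ z) (by linarith)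
      (k := -⌊D.pos z - D.pos x⌋ - 1) (by have := pos_eq z; push_cast; linarith) ?_
    intro w t k hw ht₀ ht₁ h
    have hz₀ := pos z hzS
    have hwt := eval w (φ z + t) (⌊D.pos z - D.pos x⌋ + k) (by linarith) (by linarith) (by
      have := pos_eq z
      push_cast
      linarith)
    have hwx : w ≠ x := by
      rintro rfl
      simp [hφ] at hwt
      simp only [hφ] at hz₀
      linarith
    exact absurd (hz w ⟨hw.trans hzS.1, hwx⟩) (by linarith)

/-! ### Counting elements with two drawn lower or upper neighbours -/

variable (D) in
/-- The elements with two drawn edges that lead down. -/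
def DownDouble : Set P := {e | ∃ b b', b ≠ b' ∧ D.UpEdge b e ∧ D.UpEdge b' e}

variable (D) in
/-- The elements with two drawn edges that lead up. -/
def UpDouble : Set P := {e | ∃ d d', d ≠ d' ∧ D.UpEdge e d ∧ D.UpEdge e d'}

/-- The left one of two lower neighbours determines `e`. Lower ends are compared in the lifts whose
segments end at the chosen lift of `e`, which is why the winding number is subtracted. -/
theorem NonCrossing.ncard_downDouble_le [Finite P] (hD : D.NonCrossing) (r : ℤ) :
    {e | e ∈ D.DownDouble ∧ grade ℤ e = r + 1}.ncard ≤ {b : P | grade ℤ b = r}.ncard := by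
  have left : ∀ e ∈ {e | e ∈ D.DownDouble ∧ grade ℤ e = r + 1}, ∃ b b', D.UpEdge b e ∧
      D.UpEdge b' e ∧ D.pos b - D.wind b e < D.pos b' - D.wind b' e := by
    rintro e ⟨⟨b, b', hne, h, h'⟩, -⟩
    have hg : grade ℤ b = grade ℤ b' := by have := h.grade_eq; have := h'.grade_eq; omega
    rcases lt_trichotomy (D.pos b - D.wind b e) (D.pos b' - D.wind b' e) with hlt | heq | hlt
    · exact ⟨b, b', h, h', hlt⟩
    · exact absurd (hD.1 (point_eq_iff.2 ⟨hg, D.wind b' e - D.wind b e, by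
        push_cast; linarith⟩)) hne
    · exact ⟨b', b, h', h, hlt⟩
  choose! f f' hf hf' hlt using left
  refine Set.ncard_le_ncard_of_injOn f (fun e he => ?_) ?_ (Set.toFinite _)
  · have := (hf e he).grade_eq
    have := he.2
    simp only [Set.mem_ofPred_eq]
    omega
  -- The edge from `f' e` to `e` starts to the right of `f e`, so the edge from `f e` to `e'` cannot
  -- end to the right of `e`. By symmetry the upper ends agree.
  · have key : ∀ e ∈ {e | e ∈ D.DownDouble ∧ grade ℤ e = r + 1},
        ∀ e' ∈ {e | e ∈ D.DownDouble ∧ grade ℤ e = r + 1}, f e = f e' →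
        D.pos e' + D.wind (f e) e' ≤ D.pos e + D.wind (f e) e := by
      intro e he e' he' h
      have hg := (hf e he).grade_eq.symm.trans (hf' e he).grade_eq
      have h₁ := hD.le_of_lt (h ▸ hf e' he') (hf' e he) (by omega)
        (k := D.wind (f e) e - D.wind (f' e) e) (by
          have := hlt e he
          push_cast
          linarith)
      push_cast at h₁
      linarith
    intro e he e' he' h
    have h₁ := key e he e' he' h
    have h₂ := key e' he' e he h.symm
    rw [← h] at h₂
    exact hD.1 (point_eq_iff.2 ⟨he.2.trans he'.2.symm, D.wind (f e) e - D.wind (f e) e', by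
      push_cast; linarith⟩)

/-- The upside-down version: the left one of two upper neighbours determines `e`. -/
theorem NonCrossing.ncard_upDouble_le [Finite P] (hD : D.NonCrossing) (r : ℤ) :
    {e | e ∈ D.UpDouble ∧ grade ℤ e = r}.ncard ≤ {d : P | grade ℤ d = r + 1}.ncard := by
  have left : ∀ e ∈ {e | e ∈ D.UpDouble ∧ grade ℤ e = r}, ∃ d d', D.UpEdge e d ∧
      D.UpEdge e d' ∧ D.pos d + D.wind e d < D.pos d' + D.wind e d' := by
    rintro e ⟨⟨d, d', hne, h, h'⟩, -⟩
    rcases lt_trichotomy (D.pos d + D.wind e d) (D.pos d' + D.wind e d') with hlt | heq | hlt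
    · exact ⟨d, d', h, h', hlt⟩
    · exact absurd (hD.1 (point_eq_iff.2 ⟨h.grade_eq.trans h'.grade_eq.symm,
        D.wind e d - D.wind e d', by push_cast; linarith⟩)) hne
    · exact ⟨d', d, h', h, hlt⟩
  choose! f f' hf hf' hlt using left
  refine Set.ncard_le_ncard_of_injOn f (fun e he => ?_) ?_ (Set.toFinite _)
  · have := (hf e he).grade_eq
    have := he.2
    simp only [Set.mem_ofPred_eq]
    omega
  · have key : ∀ e ∈ {e | e ∈ D.UpDouble ∧ grade ℤ e = r},
        ∀ e' ∈ {e | e ∈ D.UpDouble ∧ grade ℤ e = r}, f e = f e' →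
        D.pos e' - D.wind e' (f e) ≤ D.pos e - D.wind e (f e) := by
      intro e he e' he' h
      by_contra! hcon
      have h₁ := hD.le_of_lt (hf' e he) (h ▸ hf e' he') (he.2.trans he'.2.symm)
        (k := D.wind e (f e) - D.wind e' (f e)) (by push_cast; linarith)
      have := hlt e he
      push_cast at h₁
      linarith
    intro e he e' he' h
    have h₁ := key e he e' he' h
    have h₂ := key e' he' e he h.symm
    rw [← h] at h₂
    exact hD.1 (point_eq_iff.2 ⟨he.2.trans he'.2.symm, D.wind e' (f e) - D.wind e (f e), by
      push_cast; linarith⟩)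

end CylinderDrawing

/-! ### Hamiltonian cycles from cyclic enumerations -/

/-- A cyclic enumeration of the vertices, in which successive vertices are adjacent, is a
Hamiltonian cycle. -/
theorem hasHamiltonianCycle_of_cyclic {V : Type*} {G : SimpleGraph V} {m : ℕ} (e : Fin (m + 3) ≃ V)
    (h : ∀ i, G.Adj (e i) (e (i + 1))) : HasHamiltonianCycle G := by
  classical
  have : Fintype V := Fintype.ofEquiv _ e
  let φ : SimpleGraph.cycleGraph (m + 3) →g G := ⟨e, by
    intro a b hab
    rcases SimpleGraph.cycleGraph_adj.1 hab with hab | hab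
    · obtain rfl := sub_eq_iff_eq_add'.1 hab
      exact (h b).symm
    · obtain rfl := sub_eq_iff_eq_add'.1 hab
      exact h a⟩
  refine ⟨_, (SimpleGraph.cycleGraph.cycle m).map φ, ?_⟩
  -- Aligns the decidability instance fixed in `HasHamiltonianCycle` with the one found here.
  rw [Subsingleton.elim (fun a b => Classical.propDecidable (a = b)) (Classical.decEq V)]
  refine SimpleGraph.Walk.isHamiltonianCycle_iff_isCycle_and_length_eq.2
    ⟨SimpleGraph.cycleGraph.isCycle_cycle.map e.injective, ?_⟩
  rw [SimpleGraph.Walk.length_map, SimpleGraph.cycleGraph.length_cycle, ← Fintype.card_congr e,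
    Fintype.card_fin]

open scoped Fin.NatCast Fin.CommRing in
theorem connected_of_cyclic {V : Type*} {G : SimpleGraph V} {m : ℕ} (e : Fin (m + 3) ≃ V)
    (h : ∀ i, G.Adj (e i) (e (i + 1))) : G.Connected := by
  have key : ∀ j : ℕ, G.Reachable (e 0) (e j) := by
    intro j
    induction j with
    | zero => simp
    | succ j ih => exact ih.trans (by simpa only [Nat.cast_succ] using (h j).reachable)
  refine SimpleGraph.connected_iff_exists_forall_reachable _ |>.2 ⟨e 0, fun v => ?_⟩
  have := key (e.symm v).val
  rwa [Fin.cast_val_eq_self, e.apply_symm_apply] at this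

open scoped Fin.NatCast Fin.CommRing in
-- Deleting `e i` leaves the path `e (i + 1), …, e (i + m + 2)`, along which all remaining vertices
-- are reached.
theorem isTwoConnected_of_cyclic {V : Type*} {G : SimpleGraph V} {m : ℕ} (e : Fin (m + 3) ≃ V)
    (h : ∀ i, G.Adj (e i) (e (i + 1))) : IsTwoConnected G := by
  refine ⟨⟨e 0, e 1, e 2, ?_, ?_, ?_⟩, connected_of_cyclic e h, fun v => ?_⟩
  · simp
  · simp [Fin.ext_iff, Nat.mod_eq_of_lt (show 2 < m + 3 by omega)]
  · simp [Fin.ext_iff, Nat.mod_eq_of_lt (show 2 < m + 3 by omega)]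
  · obtain ⟨i, rfl⟩ := e.surjective v
    have hne : ∀ j : ℕ, j < m + 2 → e (i + 1 + (j : ℕ)) ∈ ({e i}ᶜ : Set V) := by
      intro j hj hji
      have h₁ := e.injective hji
      rw [add_assoc, add_eq_left] at h₁
      have h₂ := congrArg Fin.val h₁
      have h₃ : ((1 : Fin (m + 3)) + (j : Fin (m + 3))) = ((1 + j : ℕ) : Fin (m + 3)) := by
        push_cast
        rfl
      rw [h₃, Fin.val_natCast, Nat.mod_eq_of_lt (by omega)] at h₂
      simp at h₂
    have key : ∀ (j : ℕ) (hj : j < m + 2), (G.induce {e i}ᶜ).Reachable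
        ⟨e (i + 1 + (0 : ℕ)), hne 0 (by omega)⟩ ⟨e (i + 1 + (j : ℕ)), hne j hj⟩ := by
      intro j
      induction j with
      | zero => exact fun _ => SimpleGraph.Reachable.refl _
      | succ j ih =>
        intro hj
        refine (ih (by omega)).trans (SimpleGraph.Adj.reachable ?_)
        have := h (i + 1 + (j : ℕ))
        rw [add_assoc _ (j : Fin (m + 3)) 1, ← Nat.cast_succ] at this
        exact this
    refine SimpleGraph.connected_iff_exists_forall_reachable _ |>.2
      ⟨⟨e (i + 1 + (0 : ℕ)), hne 0 (by omega)⟩, fun ⟨w, hw⟩ => ?_⟩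
    have hw' : e (i + 1 + ((e.symm w - (i + 1)).val : ℕ)) = w := by
      rw [Fin.cast_val_eq_self, add_sub_cancel, e.apply_symm_apply]
    by_cases hj : (e.symm w - (i + 1)).val < m + 2
    · have := key _ hj
      simp only [hw'] at this
      exact this
    · refine absurd ?_ hw
      have h₁ : (e.symm w - (i + 1)).val = m + 2 := by omega
      rw [h₁, add_assoc] at hw'
      have h₂ : (1 + ((m + 2 : ℕ) : Fin (m + 3))) = 0 := by
        have := Fin.natCast_self (m + 3)
        rw [← this]
        push_cast
        ring
      rw [h₂, add_zero] at hw'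
      exact hw'.symm

/-- An enumeration by an initial segment of the natural numbers, given together with its inverse. -/
def enumEquiv {V : Type*} {n : ℕ} (f : ℕ → V) (idx : V → ℕ) (hf : ∀ i < n, idx (f i) = i)
    (hlt : ∀ v, idx v < n) (hidx : ∀ v, f (idx v) = v) : Fin n ≃ V where
  toFun i := f i
  invFun v := ⟨idx v, hlt v⟩
  left_inv i := Fin.ext (hf i i.2)
  right_inv := hidx

theorem fin_cyclic_rel {V : Type*} {m : ℕ} {r : V → V → Prop} (f : ℕ → V)
    (h : ∀ i < m + 2, r (f i) (f (i + 1))) (hlast : r (f (m + 2)) (f 0)) (i : Fin (m + 3)) :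
    r (f i) (f (i + 1 : Fin (m + 3))) := by
  rw [Fin.val_add_one]
  split_ifs with hi
  · rw [hi]
    exact hlast
  · exact h i (by have := Fin.val_lt_last hi; simpa using this)

/-! ### Darts, edges and faces in terms of a vertex and a neighbour index -/

namespace truncTetra

open TVertex EmbeddedGraph

variable {s : ℕ}

/-- The dart from `u` to its neighbour number `k`. -/
noncomputable def dart (u : TVertex s) (k : Fin 3) : (truncTetra s).graph.Dart :=
  cubicDart (nbr s) (nbr_symm s) (nbr_ne s) (nbr_injective s) (u, k)

/-- The edge from `u` to its neighbour number `k`. -/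
noncomputable def edge (u : TVertex s) (k : Fin 3) : (truncTetra s).graph.edgeSet :=
  ⟨(dart u k).edge, (dart u k).edge_mem⟩

/-- The face to the right of a dart. -/
noncomputable def face (u : TVertex s) (k : Fin 3) : (truncTetra s).Face :=
  (truncTetra s).faceOf (dart u k)

theorem exists_dart_eq (d : (truncTetra s).graph.Dart) : ∃ u k, dart u k = d := by
  obtain ⟨⟨u, k⟩, h⟩ := (cubicDart (nbr s) (nbr_symm s) (nbr_ne s) (nbr_injective s)).surjective d
  exact ⟨u, k, h⟩

theorem coe_edge (u : TVertex s) (k : Fin 3) : (edge u k : Sym2 (TVertex s)) = s(u, nbr s u k) :=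
  rfl

theorem rot_dart (u : TVertex s) (k : Fin 3) :
    (truncTetra s).rot (dart u k) = dart u (k + 1) := by
  set φ := cubicDart (nbr s) (nbr_symm s) (nbr_ne s) (nbr_injective s)
  exact congrArg (fun p : TVertex s × Fin 3 => φ (p.1, p.2 + 1)) (φ.symm_apply_apply (u, k))

theorem dart_symm {u w : TVertex s} {k l : Fin 3} (h : nbr s u k = w) (h' : nbr s w l = u) :
    (dart u k).symm = dart w l :=
  SimpleGraph.Dart.ext _ _ (Prod.ext h h'.symm)

theorem facePerm_dart {u w : TVertex s} {k l : Fin 3} (h : nbr s u k = w) (h' : nbr s w l = u) :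
    (truncTetra s).facePerm (dart u k) = dart w (l + 1) := by
  rw [← rot_dart, ← dart_symm h h']
  rfl

theorem face_eq {u w : TVertex s} {k l : Fin 3} (h : nbr s u k = w) (h' : nbr s w l = u) :
    face u k = face w (l + 1) := by
  rw [face, ← Cell.faceOf_facePerm, facePerm_dart h h', face]

/-- The face permutation sends the reversed dart to the rotated dart, so the face on the left of a
dart is the right face of the next dart at the same vertex. -/
theorem faceOf_dart_symm (u : TVertex s) (k : Fin 3) :
    (truncTetra s).faceOf (dart u k).symm = face u (k + 1) := by
  rw [← Cell.faceOf_facePerm, face, ← rot_dart]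
  simp [facePerm]

theorem edge_eq {u w : TVertex s} {k l : Fin 3} (h : nbr s u k = w) (h' : nbr s w l = u) :
    edge u k = edge w l := by
  refine Subtype.ext ?_
  rw [coe_edge, coe_edge, h, h', Sym2.eq_swap]

theorem vertex_lt_edge {u : TVertex s} {e : (truncTetra s).graph.edgeSet}
    (h : Cell.Lt (Cell.vertex u) (Cell.edge e)) : ∃ k, e = edge u k := by
  obtain ⟨⟨x, w⟩, he⟩ := e
  have he' : ∃ k, nbr s x k = w := he
  obtain ⟨k, rfl⟩ := he'
  have h' : u = x ∨ u = nbr s x k := Sym2.mem_iff.1 h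
  rcases h' with rfl | rfl
  · exact ⟨k, rfl⟩
  · obtain ⟨l, hl⟩ := nbr_symm s x k
    exact ⟨l, edge_eq rfl hl⟩

theorem edge_lt_face {e : (truncTetra s).graph.edgeSet} {f : (truncTetra s).Face}
    (h : Cell.Lt (Cell.edge e) (Cell.face f)) : ∃ u k, e = edge u k ∧ f = face u k := by
  obtain ⟨d, hd, rfl⟩ := h
  obtain ⟨u, k, rfl⟩ := exists_dart_eq d
  exact ⟨u, k, Subtype.ext hd.symm, rfl⟩

theorem face_of_edge_lt {u : TVertex s} {k : Fin 3} {f : (truncTetra s).Face}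
    (h : Cell.Lt (Cell.edge (edge u k)) (Cell.face f)) : f = face u k ∨ f = face u (k + 1) := by
  obtain ⟨d, hd, rfl⟩ := h
  rcases SimpleGraph.dart_edge_eq_iff d (dart u k) |>.1 hd with rfl | rfl
  · exact Or.inl rfl
  · exact Or.inr (faceOf_dart_symm u k)

theorem dual_adj {u : TVertex s} {k : Fin 3} (h : face u k ≠ face u (k + 1)) :
    (truncTetra s).dual.Adj (face u k) (face u (k + 1)) :=
  ⟨h, dart u k, rfl, faceOf_dart_symm u k⟩

end truncTetra

namespace truncTetra

open TVertex EmbeddedGraph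

variable {s : ℕ}

/-! ### The Hamiltonian cycle -/

/-- The Hamiltonian cycle: along the rails `v_4, a_1, …, a_s, v_5, b_s, …, b_1, v_6`, and then
`v_7, …, v_12, v_1, v_2, v_3`. -/
def cyc (s i : ℕ) : TVertex s :=
  if i ≤ s then railA s i else if i ≤ 2 * s + 2 then railB s (2 * s + 2 - i) else
    match i - (2 * s + 3) with
    | 0 => v7
    | 1 => v8
    | 2 => v9
    | 3 => v10
    | 4 => v11
    | 5 => v12
    | 6 => v1
    | 7 => v2
    | _ => v3

/-- The position of a vertex in the Hamiltonian cycle. -/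
def cycIdx : TVertex s → ℕ
  | v1 => 2 * s + 9
  | v2 => 2 * s + 10
  | v3 => 2 * s + 11
  | v4 => 0
  | v5 => s + 1
  | v6 => 2 * s + 2
  | v7 => 2 * s + 3
  | v8 => 2 * s + 4
  | v9 => 2 * s + 5
  | v10 => 2 * s + 6
  | v11 => 2 * s + 7
  | v12 => 2 * s + 8
  | a i => i + 1
  | b i => 2 * s + 1 - i

theorem cyc_railA {i : ℕ} (hi : i ≤ s + 1) : cyc s i = railA s i := by
  unfold cyc
  split_ifs with h₁ h₂
  · rfl
  · obtain rfl : i = s + 1 := by omega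
    rw [show 2 * s + 2 - (s + 1) = s + 1 by omega, railA_last, railB_last]
  · omega

theorem cyc_railB {i : ℕ} (hi : i ≤ s + 1) : cyc s (2 * s + 2 - i) = railB s i := by
  unfold cyc
  rw [if_neg (by omega), if_pos (by omega)]
  congr 1
  omega

theorem cyc_tail (j : ℕ) : cyc s (2 * s + 3 + j) =
    match j with
    | 0 => v7
    | 1 => v8
    | 2 => v9
    | 3 => v10
    | 4 => v11
    | 5 => v12
    | 6 => v1
    | 7 => v2
    | _ => v3 := by
  unfold cyc
  rw [if_neg (by omega), if_neg (by omega), Nat.add_sub_cancel_left]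

theorem cycIdx_railA {i : ℕ} (hi : i ≤ s + 1) : cycIdx (railA s i) = i := by
  cases i with
  | zero => rfl
  | succ i =>
    simp only [railA]
    split_ifs
    · rfl
    · simp only [cycIdx]
      omega

theorem cycIdx_railB {i : ℕ} (hi : i ≤ s + 1) : cycIdx (railB s i) = 2 * s + 2 - i := by
  cases i with
  | zero => rfl
  | succ i =>
    simp only [railB]
    split_ifs <;> simp only [cycIdx] <;> omega

/-- An index of the Hamiltonian cycle lies on one of the rails or in the rest of the cycle. -/
theorem cyc_cases {p : ℕ → Prop} (hA : ∀ i ≤ s, p i) (hB : ∀ i ≤ s + 1, p (2 * s + 2 - i))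
    (hT : ∀ j < 9, p (2 * s + 3 + j)) {i : ℕ} (hi : i < 2 * s + 12) : p i := by
  by_cases h₁ : i ≤ s
  · exact hA i h₁
  by_cases h₂ : i ≤ 2 * s + 2
  · have := hB (2 * s + 2 - i) (by omega)
    rwa [show 2 * s + 2 - (2 * s + 2 - i) = i by omega] at this
  · have := hT (i - (2 * s + 3)) (by omega)
    rwa [show 2 * s + 3 + (i - (2 * s + 3)) = i by omega] at this

theorem cycIdx_cyc {i : ℕ} (hi : i < 2 * s + 12) : cycIdx (cyc s i) = i := by
  refine cyc_cases (s := s) (p := fun i => cycIdx (cyc s i) = i) ?_ ?_ ?_ hi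
  · intro i hi
    rw [cyc_railA (by omega), cycIdx_railA (by omega)]
  · intro i hi
    rw [cyc_railB hi, cycIdx_railB hi]
  · intro j hj
    rw [cyc_tail]
    interval_cases j <;> rfl

theorem cycIdx_lt (v : TVertex s) : cycIdx v < 2 * s + 12 := by
  cases v <;> simp only [cycIdx] <;> omega

theorem cyc_cycIdx (v : TVertex s) : cyc s (cycIdx v) = v := by
  have hA := fun i (hi : i ≤ s + 1) => cyc_railA hi
  have hB := fun i (hi : i ≤ s + 1) => cyc_railB hi
  cases v
  case v4 => exact hA 0 (by omega)
  case v5 => exact (hA (s + 1) le_rfl).trans (railA_last s)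
  case v6 => exact hB 0 (by omega)
  case a i => exact (hA (i + 1) (by omega)).trans (railA_mid i)
  case b i =>
    have h := hB (i + 1) (by omega)
    rwa [railB_mid, show 2 * s + 2 - ((i : ℕ) + 1) = 2 * s + 1 - i by omega] at h
  case v7 => exact cyc_tail 0
  case v8 => exact cyc_tail 1
  case v9 => exact cyc_tail 2
  case v10 => exact cyc_tail 3
  case v11 => exact cyc_tail 4
  case v12 => exact cyc_tail 5
  case v1 => exact cyc_tail 6
  case v2 => exact cyc_tail 7
  case v3 => exact cyc_tail 8

/-- The Hamiltonian cycle, as an enumeration of the vertices. -/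
def cycEquiv (s : ℕ) : Fin (2 * s + 9 + 3) ≃ TVertex s :=
  enumEquiv (cyc s) cycIdx (fun _ => cycIdx_cyc) cycIdx_lt cyc_cycIdx

theorem adj_cycEquiv (i : Fin (2 * s + 9 + 3)) :
    (truncTetra s).graph.Adj (cycEquiv s i) (cycEquiv s (i + 1)) := by
  refine fin_cyclic_rel (r := (truncTetra s).graph.Adj) (cyc s) (fun i hi => ?_) ?_ i
  · have hi' : i < 2 * s + 12 := by omega
    revert hi
    refine cyc_cases (s := s) (p := fun i => i < 2 * s + 9 + 2 →
      (truncTetra s).graph.Adj (cyc s i) (cyc s (i + 1))) ?_ ?_ ?_ hi'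
    · intro i hi _
      rw [cyc_railA (by omega), cyc_railA (by omega)]
      exact (nbr_railA hi).1
    · intro i hi _
      obtain _ | i := i
      · have h := cyc_railB (s := s) (i := 0) (by omega)
        have h' := cyc_tail (s := s) 0
        rw [show 2 * s + 2 - 0 + 1 = 2 * s + 3 + 0 by omega, h, h']
        exact ⟨0, rfl⟩
      · rw [show 2 * s + 2 - (i + 1) + 1 = 2 * s + 2 - i by omega, cyc_railB hi,
          cyc_railB (by omega)]
        exact (nbr_railB (by omega)).2
    · intro j _ hj
      have hj' : j < 8 := by omega
      rw [add_assoc _ j 1, cyc_tail, cyc_tail]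
      interval_cases j
      exacts [⟨0, rfl⟩, ⟨0, rfl⟩, ⟨0, rfl⟩, ⟨0, rfl⟩, ⟨0, rfl⟩, ⟨0, rfl⟩, ⟨0, rfl⟩, ⟨0, rfl⟩]
  · rw [show 2 * s + 9 + 2 = 2 * s + 3 + 8 by omega, cyc_tail, cyc_railA (by omega)]
    exact ⟨0, rfl⟩

theorem card_vertex : Nat.card (TVertex s) = 2 * s + 12 := by
  rw [← Nat.card_congr (cycEquiv s), Nat.card_fin]

/-- Double counting of darts: three at each vertex, two on each edge. -/
theorem card_edgeSet : Nat.card (truncTetra s).graph.edgeSet = 3 * s + 18 := by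
  classical
  have := Fintype.ofEquiv _ (cubicDart (nbr s) (nbr_symm s) (nbr_ne s) (nbr_injective s))
  have h₁ := (truncTetra s).graph.dart_card_eq_twice_card_edges
  have h₂ := Nat.card_congr (cubicDart (nbr s) (nbr_symm s) (nbr_ne s) (nbr_injective s))
  rw [Nat.card_prod, card_vertex, Nat.card_fin] at h₂
  rw [SimpleGraph.edgeFinset, Set.toFinset_card, ← Nat.card_eq_fintype_card,
    ← Nat.card_eq_fintype_card] at h₁
  change _ = Nat.card (truncTetra s).graph.Dart at h₂
  omega

/-! ### The faces -/

/-- The faces to the right of the three darts that leave a vertex, numbered along a Hamiltonian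
cycle of the dual graph: the hexagon `v_2 v_3 v_4 v_6 v_7 v_8`, the faces between successive rungs
of the ladder up to the triangle at `v_5`, the face at `v_9 v_10`, the triangle at `v_10`, the face
at `v_3 v_4`, the triangle at `v_1`, the hexagon at `v_1 v_12`, and the triangle at `v_7`. -/
def label (s : ℕ) : TVertex s → Fin 3 → ℕ
  | v1 => ![s + 5, s + 6, s + 4]
  | v2 => ![s + 5, 0, s + 6]
  | v3 => ![s + 4, 0, s + 5]
  | v4 => ![s + 4, 1, 0]
  | v5 => ![s + 2, s + 1, s + 4]
  | v6 => ![s + 2, 0, 1]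
  | v7 => ![s + 7, 0, s + 2]
  | v8 => ![s + 7, s + 6, 0]
  | v9 => ![s + 2, s + 6, s + 7]
  | v10 => ![s + 2, s + 3, s + 6]
  | v11 => ![s + 4, s + 3, s + 2]
  | v12 => ![s + 4, s + 6, s + 3]
  | a i => ![s + 4, i + 2, i + 1]
  | b i => ![s + 2, i + 1, i + 2]

theorem label_railA {i : ℕ} (hi : i ≤ s) : label s (railA s i) 0 = s + 4 ∧
    label s (railA s i) 1 = i + 1 ∧ label s (railA s i) 2 = i ∧
    nbr s (railA s i) 0 = railA s (i + 1) ∧ nbr s (railA s i) 1 = railB s i := by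
  cases i with
  | zero => exact ⟨rfl, rfl, rfl, rfl, rfl⟩
  | succ i => simp [railA, railB, label, nbr, show i < s by omega]

theorem label_railA_succ {i : ℕ} (hi : i ≤ s) : ∃ l, nbr s (railA s (i + 1)) l = railA s i ∧
    label s (railA s (i + 1)) l = i + 1 ∧ label s (railA s (i + 1)) (l + 1) = s + 4 := by
  by_cases h : i < s
  · exact ⟨2, by simp [railA, label, nbr, h]⟩
  · obtain rfl : i = s := by omega
    exact ⟨1, by simp [railA, label, nbr]⟩

theorem label_railB {i : ℕ} (hi : i ≤ s) : label s (railB s i) 0 = s + 2 ∧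
    label s (railB s i) 1 = i ∧ label s (railB s i) 2 = i + 1 ∧
    nbr s (railB s i) 2 = railB s (i + 1) ∧ nbr s (railB s i) 1 = railA s i := by
  cases i with
  | zero => exact ⟨rfl, rfl, rfl, rfl, rfl⟩
  | succ i => simp [railA, railB, label, nbr, show i < s by omega]

theorem label_railB_succ {i : ℕ} (hi : i ≤ s) : nbr s (railB s (i + 1)) 0 = railB s i ∧
    label s (railB s (i + 1)) 0 = s + 2 ∧ label s (railB s (i + 1)) 1 = i + 1 := by
  by_cases h : i < s
  · simp [railB, label, nbr, h]
  · obtain rfl : i = s := by omega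
    simp [railB, label, nbr]

/-- The label of a dart is the label of the next dart of the same face. -/
theorem exists_label_eq (u : TVertex s) (k : Fin 3) :
    ∃ l, nbr s (nbr s u k) l = u ∧ label s (nbr s u k) (l + 1) = label s u k := by
  -- Rail darts are treated uniformly in the rail index; `i = 0` and `i = s` then yield the darts at
  -- the corners `v4`, `v6` and `v5`.
  have upA : ∀ i ≤ s, ∃ l, nbr s (nbr s (railA s i) 0) l = railA s i ∧
      label s (nbr s (railA s i) 0) (l + 1) = label s (railA s i) 0 := by
    intro i hi
    obtain ⟨h₀, -, -, h, -⟩ := label_railA hi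
    obtain ⟨l, h₁, -, h₂⟩ := label_railA_succ hi
    exact ⟨l, by rw [h, h₁], by rw [h, h₀, h₂]⟩
  have downA : ∀ i ≤ s, ∀ k, nbr s (railA s (i + 1)) k = railA s i → ∃ l,
      nbr s (nbr s (railA s (i + 1)) k) l = railA s (i + 1) ∧
      label s (nbr s (railA s (i + 1)) k) (l + 1) = label s (railA s (i + 1)) k := by
    intro i hi k hk
    obtain ⟨-, h₁, -, h, -⟩ := label_railA hi
    obtain ⟨l, h₂, h₃, -⟩ := label_railA_succ hi
    obtain rfl := nbr_injective s _ (h₂.trans hk.symm)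
    exact ⟨0, by rw [h₂, h], by rw [h₂, h₃]; exact h₁⟩
  have upB : ∀ i ≤ s, ∃ l, nbr s (nbr s (railB s i) 2) l = railB s i ∧
      label s (nbr s (railB s i) 2) (l + 1) = label s (railB s i) 2 := by
    intro i hi
    obtain ⟨-, -, h₂, h, -⟩ := label_railB hi
    obtain ⟨h₃, -, h₄⟩ := label_railB_succ hi
    exact ⟨0, by rw [h, h₃], by rw [h, h₂]; exact h₄⟩
  have downB : ∀ i ≤ s, ∃ l, nbr s (nbr s (railB s (i + 1)) 0) l = railB s (i + 1) ∧
      label s (nbr s (railB s (i + 1)) 0) (l + 1) = label s (railB s (i + 1)) 0 := by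
    intro i hi
    obtain ⟨h₀, -, -, h, -⟩ := label_railB hi
    obtain ⟨h₃, h₄, -⟩ := label_railB_succ hi
    exact ⟨2, by rw [h₃, h], by rw [h₃, h₄]; exact h₀⟩
  have hA := upA 0 (Nat.zero_le s)
  have hA' := downA s le_rfl
  have hB := upB 0 (Nat.zero_le s)
  have hB' := downB s le_rfl
  rw [railA_last] at hA'
  rw [railB_last] at hB'
  cases u
  case v4 =>
    fin_cases k
    exacts [hA, ⟨1, rfl, rfl⟩, ⟨0, rfl, rfl⟩]
  case v5 =>
    fin_cases k
    exacts [hB', hA' 1 rfl, ⟨2, rfl, rfl⟩]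
  case v6 =>
    fin_cases k
    exacts [⟨1, rfl, rfl⟩, ⟨1, rfl, rfl⟩, hB]
  case a i =>
    have h₁ := upA (i + 1) i.2
    have h₂ := downA i i.2.le 2
    rw [railA_mid] at h₁ h₂
    fin_cases k
    exacts [h₁, ⟨1, rfl, rfl⟩, h₂ rfl]
  case b i =>
    have h₁ := upB (i + 1) i.2
    have h₂ := downB i i.2.le
    rw [railB_mid] at h₁ h₂
    fin_cases k
    exacts [h₂, ⟨1, rfl, rfl⟩, h₁]
  all_goals
    fin_cases k <;> first
      | exact ⟨0, rfl, rfl⟩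
      | exact ⟨1, rfl, rfl⟩
      | exact ⟨2, rfl, rfl⟩

theorem label_lt (u : TVertex s) (k : Fin 3) : label s u k < s + 8 := by
  cases u <;> fin_cases k <;> simp [label] <;> omega

theorem label_injective (u : TVertex s) : Function.Injective (label s u) := by
  intro k l h
  cases u <;> fin_cases k <;> fin_cases l <;> simp [label] at h ⊢ <;> omega

/-- The label of the face to the right of a dart. -/
noncomputable def dartLabel (d : (truncTetra s).graph.Dart) : ℕ :=
  Function.uncurry (label s)
    ((cubicDart (nbr s) (nbr_symm s) (nbr_ne s) (nbr_injective s)).symm d)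

theorem dartLabel_dart (u : TVertex s) (k : Fin 3) : dartLabel (dart u k) = label s u k :=
  congrArg (Function.uncurry (label s)) (Equiv.symm_apply_apply _ (u, k))

theorem dartLabel_facePerm (d : (truncTetra s).graph.Dart) :
    dartLabel ((truncTetra s).facePerm d) = dartLabel d := by
  obtain ⟨u, k, rfl⟩ := exists_dart_eq d
  obtain ⟨l, h, h'⟩ := exists_label_eq u k
  rw [facePerm_dart rfl h, dartLabel_dart, dartLabel_dart, h']

/-- The number of a face. -/
noncomputable def faceIdx : (truncTetra s).Face → ℕ :=
  Quotient.lift dartLabel (by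
    rintro d _ ⟨i, rfl⟩
    -- `SameCycle` allows negative powers; working in the subgroup of label-preserving permutations
    -- covers all integer powers at once.
    let S : Subgroup (Equiv.Perm (truncTetra s).graph.Dart) :=
      { carrier := {g | ∀ d, dartLabel (g d) = dartLabel d}
        mul_mem' := fun hg hh d => (hg _).trans (hh d)
        one_mem' := fun _ => rfl
        inv_mem' := fun {g} hg d => by simpa using (hg (g⁻¹ d)).symm }
    exact (S.zpow_mem (show (truncTetra s).facePerm ∈ S from dartLabel_facePerm) i d).symm)

theorem faceIdx_face (u : TVertex s) (k : Fin 3) : faceIdx (face u k) = label s u k :=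
  dartLabel_dart u k

theorem face_ne {u w : TVertex s} {k l : Fin 3} (h : label s u k ≠ label s w l) :
    face u k ≠ face w l := by
  intro h'
  rw [← faceIdx_face, ← faceIdx_face, h'] at h
  exact h rfl

/-- The face with a given number. -/
noncomputable def faceNum (s i : ℕ) : (truncTetra s).Face :=
  if i ≤ s then face (railA s i) 2 else
    match i - (s + 1) with
    | 0 => face v5 1
    | 1 => face v5 0
    | 2 => face v10 1
    | 3 => face v4 0
    | 4 => face v1 0
    | 5 => face v1 1
    | _ => face v7 0

theorem faceNum_railA {i : ℕ} (hi : i ≤ s) : faceNum s i = face (railA s i) 2 := if_pos hi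

theorem faceNum_tail (j : ℕ) : faceNum s (s + 1 + j) =
    match j with
    | 0 => face v5 1
    | 1 => face v5 0
    | 2 => face v10 1
    | 3 => face v4 0
    | 4 => face v1 0
    | 5 => face v1 1
    | _ => face v7 0 := by
  unfold faceNum
  rw [if_neg (by omega), Nat.add_sub_cancel_left]

theorem face_railA_zero {i : ℕ} (hi : i ≤ s) : face (railA s i) 0 = faceNum s (s + 4) := by
  rw [show s + 4 = s + 1 + 3 by omega, faceNum_tail]
  induction i with
  | zero => rfl
  | succ i ih =>
    have hi' : i < s := hi
    rw [← ih hi'.le]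
    refine (face_eq (l := 2) (label_railA hi'.le).2.2.2.1 ?_).symm
    simp [railA, nbr, hi']

theorem face_railA_one {i : ℕ} (hi : i ≤ s) : face (railA s i) 1 = faceNum s (i + 1) := by
  have h₁ := (label_railA hi).2.2.2.1
  obtain ⟨l, h₂, h₃, -⟩ := label_railA_succ hi
  have h : face (railA s i) 1 = face (railA s (i + 1)) l := (face_eq h₂ h₁).symm
  rw [h]
  by_cases hs : i < s
  · rw [faceNum_railA hs]
    congr 1
    refine nbr_injective s _ (h₂.trans ?_)
    simp [railA, nbr, hs]
  · obtain rfl : i = s := by omega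
    rw [faceNum_tail (s := i) 0, railA_last]
    congr 1
    rw [railA_last] at h₂
    exact nbr_injective i _ (h₂.trans rfl)

theorem face_railB_two {i : ℕ} (hi : i ≤ s) : face (railB s i) 2 = faceNum s (i + 1) := by
  rw [← face_railA_one hi]
  exact (face_eq (l := 1) (label_railA hi).2.2.2.2 (label_railB hi).2.2.2.2).symm

theorem face_railB_one {i : ℕ} (hi : i ≤ s) : face (railB s i) 1 = faceNum s i := by
  rw [faceNum_railA hi]
  exact face_eq (l := 1) (label_railB hi).2.2.2.2 (label_railA hi).2.2.2.2

theorem face_railB_zero {i : ℕ} (hi : i ≤ s) : face (railB s i) 0 = faceNum s (s + 2) := by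
  rw [show s + 2 = s + 1 + 1 by omega, faceNum_tail]
  -- The induction runs down the rail from `v5`. Subtraction truncates, so for `j ≥ s` the index
  -- stays at 0 and the step is trivial.
  obtain ⟨j, rfl⟩ : ∃ j, i = s - j := ⟨s - i, by omega⟩
  clear hi
  change _ = face v5 0
  have step : ∀ i ≤ s, face (railB s i) 0 = face (railB s (i + 1)) 0 := fun i hi =>
    (face_eq (label_railB_succ hi).1 (label_railB hi).2.2.2.1).symm
  induction j with
  | zero =>
    rw [Nat.sub_zero, step s le_rfl, railB_last]
  | succ j ih =>
    by_cases hj : j < s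
    · rw [step _ (by omega), show s - (j + 1) + 1 = s - j by omega, ih]
    · rw [show s - (j + 1) = s - j by omega, ih]

/-- Darts with equal labels lie on the same face, so the labels count faces exactly. The equalities
`e1` to `e26` walk around the faces outside the ladder; the rail lemmas supply the others. -/
theorem faceNum_label (u : TVertex s) (k : Fin 3) : faceNum s (label s u k) = face u k := by
  have e1 : face (s := s) v4 2 = face v3 1 := face_eq (l := 0) rfl rfl
  have e2 : face (s := s) v3 1 = face v2 1 := face_eq (l := 0) rfl rfl
  have e3 : face (s := s) v2 1 = face v8 2 := face_eq (l := 1) rfl rfl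
  have e4 : face (s := s) v8 2 = face v7 1 := face_eq (l := 0) rfl rfl
  have e5 : face (s := s) v7 1 = face v6 1 := face_eq (l := 0) rfl rfl
  have e6 : face (s := s) v1 1 = face v12 1 := face_eq (l := 0) rfl rfl
  have e7 : face (s := s) v12 1 = face v10 2 := face_eq (l := 1) rfl rfl
  have e8 : face (s := s) v10 2 = face v9 1 := face_eq (l := 0) rfl rfl
  have e9 : face (s := s) v9 1 = face v8 1 := face_eq (l := 0) rfl rfl
  have e10 : face (s := s) v8 1 = face v2 2 := face_eq (l := 1) rfl rfl
  have e11 : face (s := s) v5 2 = face v11 0 := face_eq (l := 2) rfl rfl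
  have e12 : face (s := s) v11 0 = face v12 0 := face_eq (l := 2) rfl rfl
  have e13 : face (s := s) v12 0 = face v1 2 := face_eq (l := 1) rfl rfl
  have e14 : face (s := s) v1 2 = face v3 0 := face_eq (l := 2) rfl rfl
  have e15 : face (s := s) v3 0 = face v4 0 := face_eq (l := 2) rfl rfl
  have e16 : face (s := s) v6 0 = face v7 2 := face_eq (l := 1) rfl rfl
  have e17 : face (s := s) v7 2 = face v9 0 := face_eq (l := 2) rfl rfl
  have e18 : face (s := s) v9 0 = face v10 0 := face_eq (l := 2) rfl rfl
  have e19 : face (s := s) v10 0 = face v11 2 := face_eq (l := 1) rfl rfl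
  have e20 : face (s := s) v11 2 = face v5 0 := face_eq (l := 2) rfl rfl
  have e21 : face (s := s) v1 0 = face v2 0 := face_eq (l := 2) rfl rfl
  have e22 : face (s := s) v2 0 = face v3 2 := face_eq (l := 1) rfl rfl
  have e23 : face (s := s) v7 0 = face v8 0 := face_eq (l := 2) rfl rfl
  have e24 : face (s := s) v8 0 = face v9 2 := face_eq (l := 1) rfl rfl
  have e25 : face (s := s) v10 1 = face v12 2 := face_eq (l := 1) rfl rfl
  have e26 : face (s := s) v12 2 = face v11 1 := face_eq (l := 0) rfl rfl
  have f0 : faceNum s 0 = face v4 2 := faceNum_railA (Nat.zero_le s)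
  have f1 : faceNum s (s + 1) = face v5 1 := faceNum_tail 0
  have f2 : faceNum s (s + 2) = face v5 0 := faceNum_tail 1
  have f3 : faceNum s (s + 3) = face v10 1 := faceNum_tail 2
  have f4 : faceNum s (s + 4) = face v4 0 := faceNum_tail 3
  have f5 : faceNum s (s + 5) = face v1 0 := faceNum_tail 4
  have f6 : faceNum s (s + 6) = face v1 1 := faceNum_tail 5
  have f7 : faceNum s (s + 7) = face v7 0 := faceNum_tail 6
  have h4 := face_railA_one (Nat.zero_le s)
  have h6 := face_railB_two (Nat.zero_le s)
  cases u
  case v4 =>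
    fin_cases k
    exacts [f4, h4.symm, f0]
  case v6 =>
    fin_cases k
    exacts [by simp [label, *], by simp [label, *], h6.symm]
  case a i =>
    have h₀ := face_railA_zero (i := i + 1) i.2
    have h₁ := face_railA_one (i := i + 1) i.2
    have h₂ := faceNum_railA (i := i + 1) i.2
    rw [railA_mid] at h₀ h₁ h₂
    fin_cases k
    exacts [h₀.symm, h₁.symm, h₂]
  case b i =>
    have h₀ := face_railB_zero (i := i + 1) i.2
    have h₁ := face_railB_one (i := i + 1) i.2
    have h₂ := face_railB_two (i := i + 1) i.2
    rw [railB_mid] at h₀ h₁ h₂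
    fin_cases k
    exacts [h₀.symm, h₁.symm, h₂.symm]
  all_goals fin_cases k <;> simp [label, *]

/-- The numbering of the faces, along a Hamiltonian cycle of the dual graph. -/
noncomputable def faceEquiv (s : ℕ) : Fin (s + 5 + 3) ≃ (truncTetra s).Face :=
  enumEquiv (faceNum s) faceIdx (by
    intro i hi
    by_cases h : i ≤ s
    · rw [faceNum_railA h, faceIdx_face, (label_railA h).2.2.1]
    · obtain ⟨j, rfl⟩ : ∃ j, i = s + 1 + j := ⟨i - (s + 1), by omega⟩
      have hj : j < 7 := by omega
      rw [faceNum_tail]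
      interval_cases j <;> exact faceIdx_face _ _)
    (by
      rintro ⟨d⟩
      obtain ⟨u, k, rfl⟩ := exists_dart_eq d
      exact (faceIdx_face u k).trans_lt (label_lt u k))
    (by
      rintro ⟨d⟩
      obtain ⟨u, k, rfl⟩ := exists_dart_eq d
      exact (congrArg _ (faceIdx_face u k)).trans (faceNum_label u k))

/-- Successive labels at a vertex number the faces on the two sides of one edge, so dual adjacency
can be read off the table `label`. -/
theorem dual_adj_faceNum {i j : ℕ} (u : TVertex s) (k : Fin 3) (h : label s u k = i)
    (h' : label s u (k + 1) = j) : (truncTetra s).dual.Adj (faceNum s i) (faceNum s j) := by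
  rw [← h, ← h', faceNum_label, faceNum_label]
  refine dual_adj (face_ne fun h => ?_)
  have := label_injective u h
  simp at this

theorem dual_adj_faceEquiv (i : Fin (s + 5 + 3)) :
    (truncTetra s).dual.Adj (faceEquiv s i) (faceEquiv s (i + 1)) := by
  refine fin_cyclic_rel (r := (truncTetra s).dual.Adj) (faceNum s) (fun i hi => ?_) ?_ i
  · by_cases h : i ≤ s
    -- The faces numbered `i` and `i + 1` are separated by the rung at height `i`, which is `v4 v6`
    -- for `i = 0`.
    · exact (dual_adj_faceNum (railA s i) 1 (label_railA h).2.1 (label_railA h).2.2.1).symm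
    · obtain ⟨j, rfl⟩ : ∃ j, i = s + 1 + j := ⟨i - (s + 1), by omega⟩
      have hj : j < 6 := by omega
      interval_cases j
      exacts [(dual_adj_faceNum v5 0 rfl rfl).symm, dual_adj_faceNum v10 0 rfl rfl,
        (dual_adj_faceNum v11 0 rfl rfl).symm, dual_adj_faceNum v1 2 rfl rfl,
        dual_adj_faceNum v1 0 rfl rfl, (dual_adj_faceNum v8 0 rfl rfl).symm]
  · exact (dual_adj_faceNum v8 2 rfl rfl).symm

theorem card_face : Nat.card (truncTetra s).Face = s + 8 := by
  rw [← Nat.card_congr (faceEquiv s), Nat.card_fin]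

theorem isPlane (s : ℕ) : (truncTetra s).IsPlane := by
  refine ⟨inferInstance, connected_of_cyclic (cycEquiv s) adj_cycEquiv, ?_⟩
  rw [card_vertex, card_edgeSet, card_face]
  push_cast
  ring

end truncTetra

namespace truncTetra

open TVertex EmbeddedGraph CylinderDrawing

variable {s : ℕ}

/-! ### There is no rhombic strip -/

instance : Finite (truncTetra s).Face := Finite.of_equiv _ (faceEquiv s)

instance : Finite (truncTetra s).Cell := by
  refine Finite.of_surjective (α := TVertex s ⊕ (truncTetra s).graph.edgeSet ⊕
    (truncTetra s).Face ⊕ Bool) (fun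
      | .inl v => .vertex v
      | .inr (.inl e) => .edge e
      | .inr (.inr (.inl f)) => .face f
      | .inr (.inr (.inr t)) => if t then .whole else .empty) ?_
  rintro (_ | v | e | f | _)
  exacts [⟨.inr (.inr (.inr false)), rfl⟩, ⟨.inl v, rfl⟩, ⟨.inr (.inl e), rfl⟩,
    ⟨.inr (.inr (.inl f)), rfl⟩, ⟨.inr (.inr (.inr true)), rfl⟩]

/-! ### Cells of each rank and their number -/

theorem grade_vertex (v : TVertex s) : grade ℤ (Cell.vertex v : (truncTetra s).Cell) = 0 := rfl

theorem grade_edge (e : (truncTetra s).graph.edgeSet) :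
    grade ℤ (Cell.edge e : (truncTetra s).Cell) = 1 := rfl

theorem grade_face (f : (truncTetra s).Face) :
    grade ℤ (Cell.face f : (truncTetra s).Cell) = 2 := rfl

theorem exists_vertex_of_grade {c : (truncTetra s).Cell} (h : grade ℤ c = 0) :
    ∃ v, c = Cell.vertex v := by
  change c.dim = _ at h
  cases c <;> simp_all [Cell.dim]

theorem exists_edge_of_grade {c : (truncTetra s).Cell} (h : grade ℤ c = 1) :
    ∃ e, c = Cell.edge e := by
  change c.dim = _ at h
  cases c <;> simp_all [Cell.dim]

theorem exists_face_of_grade {c : (truncTetra s).Cell} (h : grade ℤ c = 2) :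
    ∃ f, c = Cell.face f := by
  change c.dim = _ at h
  cases c <;> simp_all [Cell.dim]

theorem ncard_grade_zero : {c : (truncTetra s).Cell | grade ℤ c = 0}.ncard = 2 * s + 12 := by
  rw [← card_vertex, ← Set.ncard_univ, ← Set.ncard_image_of_injective Set.univ
    (f := (Cell.vertex : _ → (truncTetra s).Cell)) fun _ _ => Cell.vertex.inj]
  congr 1
  ext c
  simp only [Set.image_univ, Set.mem_range]
  exact ⟨fun h => (exists_vertex_of_grade h).imp fun _ => Eq.symm, by rintro ⟨v, rfl⟩; rfl⟩

theorem ncard_grade_one : {c : (truncTetra s).Cell | grade ℤ c = 1}.ncard = 3 * s + 18 := by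
  rw [← card_edgeSet, ← Set.ncard_univ, ← Set.ncard_image_of_injective Set.univ
    (f := (Cell.edge : _ → (truncTetra s).Cell)) fun _ _ => Cell.edge.inj]
  congr 1
  ext c
  simp only [Set.image_univ, Set.mem_range]
  exact ⟨fun h => (exists_edge_of_grade h).imp fun _ => Eq.symm, by rintro ⟨v, rfl⟩; rfl⟩

theorem ncard_grade_two : {c : (truncTetra s).Cell | grade ℤ c = 2}.ncard = s + 8 := by
  rw [← card_face, ← Set.ncard_univ, ← Set.ncard_image_of_injective Set.univ
    (f := (Cell.face : _ → (truncTetra s).Cell)) fun _ _ => Cell.face.inj]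
  congr 1
  ext c
  simp only [Set.image_univ, Set.mem_range]
  exact ⟨fun h => (exists_face_of_grade h).imp fun _ => Eq.symm, by rintro ⟨v, rfl⟩; rfl⟩

theorem edge_injective (u : TVertex s) : Function.Injective (edge u) := by
  intro k l h
  refine nbr_injective s u ?_
  have h' := congrArg Subtype.val h
  rwa [coe_edge, coe_edge, Sym2.congr_right] at h'

theorem face_injective (u : TVertex s) : Function.Injective (face u) := by
  intro k l h
  by_contra hkl
  exact face_ne (fun h => hkl (label_injective u h)) h

theorem exists_edge_eq (e : (truncTetra s).graph.edgeSet) : ∃ u k, e = edge u k := by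
  obtain ⟨⟨u, w⟩, he⟩ := e
  obtain ⟨k, hk⟩ : ∃ k, nbr s u k = w := he
  exact ⟨u, k, Subtype.ext (congrArg (fun w => s(u, w)) hk.symm)⟩

/-! ### Local constraints of a strip at vertices, faces, edges and triangles -/

variable {D : CylinderDrawing (truncTetra s).Cell}

theorem upEdge_vertex {u : TVertex s} {c : (truncTetra s).Cell} (h : D.UpEdge (Cell.vertex u) c) :
    ∃ k, c = Cell.edge (edge u k) := by
  obtain ⟨e, rfl⟩ := exists_edge_of_grade (h.grade_eq.trans (by rw [grade_vertex, zero_add]))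
  obtain ⟨k, rfl⟩ := vertex_lt_edge h.2.lt
  exact ⟨k, rfl⟩

theorem upEdge_edge {u : TVertex s} {k : Fin 3} {c : (truncTetra s).Cell}
    (h : D.UpEdge (Cell.edge (edge u k)) c) :
    c = Cell.face (face u k) ∨ c = Cell.face (face u (k + 1)) := by
  obtain ⟨f, rfl⟩ := exists_face_of_grade (h.grade_eq.trans (by rw [grade_edge]; rfl))
  rcases face_of_edge_lt h.2.lt with rfl | rfl
  exacts [Or.inl rfl, Or.inr rfl]

theorem upEdge_to_edge {u : TVertex s} {k : Fin 3} {c : (truncTetra s).Cell}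
    (h : D.UpEdge c (Cell.edge (edge u k))) :
    c = Cell.vertex u ∨ c = Cell.vertex (nbr s u k) := by
  obtain ⟨v, rfl⟩ := exists_vertex_of_grade (c := c) (by
    have := h.grade_eq
    rw [grade_edge] at this
    omega)
  have hv : v = u ∨ v = nbr s u k := Sym2.mem_iff.1 (show v ∈ s(u, nbr s u k) from h.2.lt)
  rcases hv with rfl | rfl
  exacts [Or.inl rfl, Or.inr rfl]

/-- At every vertex, at most one edge is joined to only one of its end vertices. -/
theorem edge_mem_downDouble (hD : D.NonCrossing) (hR : ∀ U, D.IsFace U → D.IsRhombus U)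
    (u : TVertex s) {k l : Fin 3} (hkl : k ≠ l) :
    Cell.edge (edge u k) ∈ D.DownDouble ∨ Cell.edge (edge u l) ∈ D.DownDouble := by
  obtain ⟨y, z, hyz, ⟨hy, b, d, -, -, h₁, h₂⟩, hz, b', d', -, -, h₃, h₄⟩ :=
    hD.exists_opposite hR (x := Cell.vertex u) (u := Cell.vertex (nbr s u 0))
      (v := Cell.vertex (nbr s u 1)) rfl rfl (fun h => nbr_ne s u 0 (Cell.vertex.inj h))
      (fun h => nbr_ne s u 1 (Cell.vertex.inj h)) (fun h => by
        have := nbr_injective s u (Cell.vertex.inj h)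
        simp at this)
  obtain ⟨i, rfl⟩ := upEdge_vertex h₁
  obtain ⟨j, rfl⟩ := upEdge_vertex h₃
  have hi : Cell.edge (edge u i) ∈ D.DownDouble := ⟨_, y, hy, h₁, h₂⟩
  have hj : Cell.edge (edge u j) ∈ D.DownDouble := ⟨_, z, hz, h₃, h₄⟩
  -- An edge at `u` has only one other end, so distinct opposite vertices use distinct edges.
  have hij : i ≠ j := by
    rintro rfl
    exact hyz (((upEdge_to_edge h₂).resolve_left hy.symm).trans
      ((upEdge_to_edge h₄).resolve_left hz.symm).symm)
  -- Two pairs in a three-element set always intersect.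
  have : i = k ∨ i = l ∨ j = k ∨ j = l := by
    clear * - hij hkl
    revert i j k l
    decide
  rcases this with rfl | rfl | rfl | rfl
  exacts [Or.inl hi, Or.inr hi, Or.inl hj, Or.inr hj]

/-- Every face has two edges that are joined to the faces on both of their sides. -/
theorem exists_upDouble (hD : D.NonCrossing) (hR : ∀ U, D.IsFace U → D.IsRhombus U)
    (u : TVertex s) (k : Fin 3) : ∃ e e', e ≠ e' ∧
      Cell.Lt (Cell.edge e) (Cell.face (face u k)) ∧
      Cell.Lt (Cell.edge e') (Cell.face (face u k)) ∧
      Cell.edge e ∈ D.UpDouble ∧ Cell.edge e' ∈ D.UpDouble := by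
  have ne : ∀ {i j : Fin 3}, i ≠ j →
      (Cell.face (face u i) : (truncTetra s).Cell) ≠ Cell.face (face u j) :=
    fun hij h => hij (face_injective u (Cell.face.inj h))
  obtain ⟨y, z, hyz, ⟨hy, b, d, h₁, h₂, -, -⟩, hz, b', d', h₃, h₄, -, -⟩ :=
    hD.exists_opposite hR (x := Cell.face (face u k)) (u := Cell.face (face u (k + 1)))
      (v := Cell.face (face u (k + 2))) rfl rfl (ne (by simp)) (ne (by simp)) (ne (by simp))
  have grade_eq_one : ∀ {b : (truncTetra s).Cell}, D.UpEdge b (Cell.face (face u k)) →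
      grade ℤ b = 1 := by
    intro b h
    have := h.grade_eq
    rw [grade_face] at this
    omega
  obtain ⟨e, rfl⟩ := exists_edge_of_grade (grade_eq_one h₁)
  obtain ⟨e', rfl⟩ := exists_edge_of_grade (grade_eq_one h₃)
  refine ⟨e, e', ?_, h₁.2.lt, h₃.2.lt, ⟨_, y, hy, h₁, h₂⟩, ⟨_, z, hz, h₃, h₄⟩⟩
  -- Otherwise the given face, `y` and `z` would be three distinct faces on a single edge.
  rintro rfl
  obtain ⟨w, l, rfl⟩ := exists_edge_eq e
  have := upEdge_edge h₁
  have := upEdge_edge h₂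
  have := upEdge_edge h₄
  grind

/-- Every edge is joined to both of its end vertices or to the faces on both of its sides. -/
theorem mem_downDouble_or_upDouble (hD : D.NonCrossing) (hR : ∀ U, D.IsFace U → D.IsRhombus U)
    (e : (truncTetra s).graph.edgeSet) :
    Cell.edge e ∈ D.DownDouble ∨ Cell.edge e ∈ D.UpDouble := by
  obtain ⟨u, k, rfl⟩ := exists_edge_eq e
  have ne : ∀ {i j : Fin 3}, i ≠ j →
      (Cell.edge (edge u i) : (truncTetra s).Cell) ≠ Cell.edge (edge u j) :=
    fun hij h => hij (edge_injective u (Cell.edge.inj h))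
  obtain ⟨y, z, hyz, ⟨hy, b, d, h₁, h₂, h₃, h₄⟩, hz, b', d', h₁', h₂', h₃', h₄'⟩ :=
    hD.exists_opposite hR (x := Cell.edge (edge u k)) (u := Cell.edge (edge u (k + 1)))
      (v := Cell.edge (edge u (k + 2))) rfl rfl (ne (by simp)) (ne (by simp)) (ne (by simp))
  -- With only one lower neighbour `b` and one upper neighbour `d`, the edge, `y` and `z` are three
  -- distinct edges at the vertex `b` lying on the face `d`; but `face w m` contains only the edges
  -- numbered `m` and `m - 1` at `w`.
  by_contra! hcon
  obtain rfl : b = b' := by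
    by_contra hb
    exact hcon.1 ⟨b, b', hb, h₁, h₁'⟩
  obtain rfl : d = d' := by
    by_contra hd
    exact hcon.2 ⟨d, d', hd, h₃, h₃'⟩
  obtain ⟨w, rfl⟩ : ∃ w, b = Cell.vertex w := by
    rcases upEdge_to_edge h₁ with rfl | rfl
    exacts [⟨_, rfl⟩, ⟨_, rfl⟩]
  obtain ⟨i, hi⟩ := upEdge_vertex h₁
  obtain ⟨j, rfl⟩ := upEdge_vertex h₂
  obtain ⟨l, rfl⟩ := upEdge_vertex h₂'
  rw [hi] at h₃ hy hz
  have hij : i ≠ j := by rintro rfl; exact hy rfl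
  have hil : i ≠ l := by rintro rfl; exact hz rfl
  have hjl : j ≠ l := by rintro rfl; exact hyz rfl
  obtain ⟨m, rfl⟩ : ∃ m, d = Cell.face (face w m) := by
    rcases upEdge_edge h₃ with rfl | rfl
    exacts [⟨_, rfl⟩, ⟨_, rfl⟩]
  have corner : ∀ {n : Fin 3}, D.UpEdge (Cell.edge (edge w n)) (Cell.face (face w m)) →
      m = n ∨ m = n + 1 := fun h => (upEdge_edge h).imp
    (fun h => face_injective w (Cell.face.inj h)) (fun h => face_injective w (Cell.face.inj h))
  have c₁ := corner h₃
  have c₂ := corner h₄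
  have c₃ := corner h₄'
  clear * - hij hil hjl c₁ c₂ c₃
  revert i j l m
  decide

/-- A triangular face has an edge that is joined to both of its end vertices and to the faces on both
of its sides. -/
theorem exists_mem_of_triangle (hD : D.NonCrossing) (hR : ∀ U, D.IsFace U → D.IsRhombus U)
    {u v w : TVertex s} {i i' j j' k k' : Fin 3} (hi : nbr s u i = v) (hi' : nbr s v i' = u)
    (hj : nbr s v j = w) (hj' : nbr s w j' = v) (hk : nbr s w k = u) (hk' : nbr s u k' = w)
    (h₁ : i ≠ k') (h₂ : i' ≠ j) (h₃ : j' ≠ k)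
    (hf : ∀ x l, face x l = face u i → edge x l = edge u i ∨ edge x l = edge v j ∨
      edge x l = edge w k) :
    ∃ e, (e = edge u i ∨ e = edge v j ∨ e = edge w k) ∧
      Cell.edge e ∈ D.DownDouble ∧ Cell.edge e ∈ D.UpDouble := by
  -- Any two sides share a corner, so at most one side is not in `DownDouble`; with two sides in
  -- `UpDouble`, some side is in both.
  have d₁ := edge_mem_downDouble hD hR u h₁
  have d₂ := edge_mem_downDouble hD hR v h₂
  have d₃ := edge_mem_downDouble hD hR w h₃
  rw [edge_eq hk' hk] at d₁
  rw [edge_eq hi' hi] at d₂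
  rw [edge_eq hj' hj] at d₃
  obtain ⟨e, e', hne, he, he', hu, hu'⟩ := exists_upDouble hD hR u i
  have hf' : ∀ {e}, Cell.Lt (Cell.edge e) (Cell.face (face u i)) → e = edge u i ∨ e = edge v j ∨
      e = edge w k := by
    intro e he
    obtain ⟨x, l, rfl, h⟩ := edge_lt_face he
    exact hf x l h.symm
  rcases hf' he with rfl | rfl | rfl <;> rcases hf' he' with rfl | rfl | rfl <;> grind

/-- The triangles at `v1`, `v7` and `v10` suffice; they do not change with `s`, unlike the triangle
at `v5`. -/
theorem not_hasRhombicStrip (s : ℕ) : ¬ HasRhombicStrip (truncTetra s).Cell := by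
  rintro ⟨D, hD, hR⟩
  have label_eq : ∀ {x u : TVertex s} {l i : Fin 3}, face x l = face u i →
      label s x l = label s u i := by
    intro x u l i h
    rw [← faceIdx_face, h, faceIdx_face]
  obtain ⟨e₁, h₁, hd₁, hu₁⟩ := exists_mem_of_triangle hD hR (u := v1) (v := v2) (w := v3)
    (i := 0) (i' := 2) (j := 0) (j' := 1) (k := 2) (k' := 2) rfl rfl rfl rfl rfl rfl
    (by decide) (by decide) (by decide) (by
      intro x l h
      have h' := label_eq h
      cases x <;> fin_cases l <;> simp [label] at h' ⊢ <;> omega)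
  obtain ⟨e₂, h₂, hd₂, hu₂⟩ := exists_mem_of_triangle hD hR (u := v7) (v := v8) (w := v9)
    (i := 0) (i' := 2) (j := 0) (j' := 1) (k := 2) (k' := 2) rfl rfl rfl rfl rfl rfl
    (by decide) (by decide) (by decide) (by
      intro x l h
      have h' := label_eq h
      cases x <;> fin_cases l <;> simp [label] at h' ⊢ <;> omega)
  -- The order `v10, v12, v11` keeps the triangle to the right of the three darts.
  obtain ⟨e₃, h₃, hd₃, hu₃⟩ := exists_mem_of_triangle hD hR (u := v10) (v := v12) (w := v11)
    (i := 1) (i' := 1) (j := 2) (j' := 0) (k := 1) (k' := 0) rfl rfl rfl rfl rfl rfl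
    (by decide) (by decide) (by decide) (by
      intro x l h
      have h' := label_eq h
      cases x <;> fin_cases l <;> simp [label] at h' ⊢ <;> omega)
  have h₁₂ : e₁ ≠ e₂ := by
    rcases h₁ with rfl | rfl | rfl <;> rcases h₂ with rfl | rfl | rfl <;>
      simp [Subtype.ext_iff, coe_edge, nbr]
  have h₁₃ : e₁ ≠ e₃ := by
    rcases h₁ with rfl | rfl | rfl <;> rcases h₃ with rfl | rfl | rfl <;>
      simp [Subtype.ext_iff, coe_edge, nbr]
  have h₂₃ : e₂ ≠ e₃ := by
    rcases h₂ with rfl | rfl | rfl <;> rcases h₃ with rfl | rfl | rfl <;>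
      simp [Subtype.ext_iff, coe_edge, nbr]
  have hA := hD.ncard_downDouble_le 0
  have hB := hD.ncard_upDouble_le 1
  rw [ncard_grade_zero] at hA
  rw [show (1 : ℤ) + 1 = 2 from rfl, ncard_grade_two] at hB
  rw [zero_add] at hA
  set A := {e | e ∈ D.DownDouble ∧ grade ℤ e = 1}
  set B := {e | e ∈ D.UpDouble ∧ grade ℤ e = 1}
  have hAB : 3 * s + 18 ≤ (A ∪ B).ncard := by
    rw [← ncard_grade_one]
    refine Set.ncard_le_ncard (fun c hc => ?_) (Set.toFinite _)
    obtain ⟨e, rfl⟩ := exists_edge_of_grade hc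
    exact (mem_downDouble_or_upDouble hD hR e).imp (fun h => ⟨h, rfl⟩) (fun h => ⟨h, rfl⟩)
  have hcard := Set.ncard_union_add_ncard_inter A B
  have hthree : 2 < (A ∩ B).ncard := by
    rw [Set.two_lt_ncard_iff]
    refine ⟨Cell.edge e₁, Cell.edge e₂, Cell.edge e₃, ⟨⟨hd₁, rfl⟩, hu₁, rfl⟩,
      ⟨⟨hd₂, rfl⟩, hu₂, rfl⟩, ⟨⟨hd₃, rfl⟩, hu₃, rfl⟩, ?_, ?_, ?_⟩
    exacts [fun h => h₁₂ (Cell.edge.inj h), fun h => h₁₃ (Cell.edge.inj h),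
      fun h => h₂₃ (Cell.edge.inj h)]
  -- The contradiction is (3s + 18) + 3 ≤ |A ∪ B| + |A ∩ B| = |A| + |B| ≤ (2s + 12) + (s + 8).
  omega

end truncTetra

theorem theorem7p4 (s : ℕ) :
    (truncTetra s).IsPlane ∧ IsTwoConnected (truncTetra s).graph ∧
      HasHamiltonianCycle (truncTetra s).graph ∧ HasHamiltonianCycle (truncTetra s).dual ∧
      ¬ HasRhombicStrip (truncTetra s).Cell :=
  ⟨truncTetra.isPlane s, isTwoConnected_of_cyclic (truncTetra.cycEquiv s) truncTetra.adj_cycEquiv,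
    hasHamiltonianCycle_of_cyclic (truncTetra.cycEquiv s) truncTetra.adj_cycEquiv,
    hasHamiltonianCycle_of_cyclic (truncTetra.faceEquiv s) truncTetra.dual_adj_faceEquiv,
    truncTetra.not_hasRhombicStrip s⟩
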